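/- Let $G=\langle a,b,c,d\mid aba^{-1}b^{-1}cdc^{-1}d^{-1}\rangle$ be the fundamental group of the closed orientable surface of genus $2$, and let $\Omega=\{a^{\pm1},b^{\pm1},c^{\pm1},d^{\pm1}\}$. The length of a conjugacy class of $G$ is the least length of a word over $\Omega$ that represents an element of the class; a class is primitive if it is not the class of a proper power $h^k$, $h\in G$, $k\ge 2$. Embed the Cayley graph of $G$ in the hyperbolic plane as the tessellation by octagons, eight at each vertex, so that the boundary of each octagon reads the relator counterclockwise. The counterclockwise order of the edges leaving a vertex is then $a,d,c^{-1},d^{-1},c,b,a^{-1},b^{-1}$. For $x\in\Omega$ let $t_k(x)$ $(1\le k\le 7)$ be the $k$-th edge clockwise from $x^{-1}$ at the end of the edge $x$, so that $t_1(x)$ is the leftmost and $t_7(x)$ the rightmost continuation of $x$. For $x\in\Omega$ let $m(x)\in\Omega$ be the label of the edge lying on the right-hand half of the octagon to the right of $x$ that ends where $x$ ends (that is, $m(x)$ precedes $x^{-1}$ in the cyclic word $aba^{-1}b^{-1}cdc^{-1}d^{-1}$). Consider the topological Markov chain with the following $88$ states, where $x\in\Omega$ is the leftmost edge of the step that the state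 stands for: $A_x$, $A'^L_x$, $A'^R_x$, $A''^L_x$, $A''^R_x$ (the single edge $x$); $B_x$ (the first edges, $x$ on the left, along both halves of the boundary of an octagon); $C_x$, $C'_x$, $D_x$ (the second, third and fourth edges along the two halves); $E^L_x$, $E^R_x$ (the last edges along both halves of an octagon together with the first edge of a new octagon that shares with the old one its last edge on the left, respectively right). The admissible transitions are: - from $A_x$, $A'^L_x$, $A'^R_x$ to $B_{t_k(x)}$ for $1\le k\le 6$ and to $A_{t_k(x)}$ for $2\le k\le 6$; further from $A_x$ to $A'^L_{t_1(x)}$ and $A'^R_{t_7(x)}$, from $A'^L_x$ to $A''^L_{t_1(x)}$ and $A'^R_{t_7(x)}$, and from $A'^R_x$ to $A'^L_{t_1(x)}$ and $A''^R_{t_7(x)}$; - from $A''^L_x$ to $B_{t_k(x)}$ and $A_{t_k(x)}$ for $2\le k\le 6$ and to $A'^R_{t_7(x)}$; from $A''^R_x$ to $B_{t_k(x)}$ for $1\le k\le 5$, to $A_{t_k(x)}$ for $2\le k\le 6$ and to $A'^L_{t_1(x)}$; - from $D_x$ to $B_{t_k(x)}$ for $1\le k\le 5$, to $A_{t_k(x)}$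 for $2\le k\le 5$, to $A'^L_{t_1(x)}$ and to $A'^R_{t_6(x)}$; - from $B_x$ to $C_{t_7(x)}$; from $C_x$ to $C'_{t_7(x)}$; from $C'_x$ to $D_{t_7(x)}$, to $E^R_{t_7(x)}$ and to $E^L_y$, where $y$ is the edge immediately counterclockwise of $t_7(x)$; from $E^L_x$ to $C_{t_7(x)}$; from $E^R_x$ to $C_{t_7(m(x))}$. For a bi-infinite admissible sequence of states $J=(J_i)_{i\in\mathbb Z}$ of least period $n$ under the shift, let $p_n(J)$ be the conjugacy class in $G$ of the word formed by the leftmost edges of $J_0,\dots,J_{n-1}$. Then, for every $n>6$, $p_n$ maps the set of bi-infinite admissible sequences of least period $n$ into the set of primitive conjugacy classes of $G$ of length $n$, and every primitive conjugacy class of $G$ of length $n$ has exactly $n$ preimages under $p_n$. -/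

import Mathlib

namespace SurfaceChain

/-- The four generators of the fundamental group of the closed orientable surface of genus two. -/
inductive Gen
  | a | b | c | d
  deriving DecidableEq

instance : Fintype Gen := ⟨{.a, .b, .c, .d}, by intro x; cases x <;> decide⟩

/-- The alphabet of generators and their inverses: `(x, true)` stands for the generator `x` and
`(x, false)` for its inverse (this is Mathlib's convention for words in a free group). -/
abbrev Letter := Gen × Bool

/-- The relator `a b a⁻¹ b⁻¹ c d c⁻¹ d⁻¹`. -/
def relator : List Letter :=
  [(.a, true), (.b, true), (.a, false), (.b, false),
   (.c, true), (.d, true), (.c, false), (.d, false)]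

/-- The genus two surface group `⟨a, b, c, d | a b a⁻¹ b⁻¹ c d c⁻¹ d⁻¹⟩`. -/
abbrev SurfaceGroup : Type := PresentedGroup ({FreeGroup.mk relator} : Set (FreeGroup Gen))

/-- The element of the surface group that a word spells. -/
def wordValue (w : List Letter) : SurfaceGroup :=
  PresentedGroup.mk ({FreeGroup.mk relator} : Set (FreeGroup Gen)) (FreeGroup.mk w)

/-- The word length of a conjugacy class: the least length of a word in the generators and their
inverses that spells an element of the class. -/
noncomputable def classLength (c : ConjClasses SurfaceGroup) : ℕ :=
  sInf {m | ∃ w : List Letter, w.length = m ∧ ConjClasses.mk (wordValue w) = c}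

/-- A conjugacy class is primitive if it is not the class of a proper power. -/
def IsPrimitiveClass (c : ConjClasses SurfaceGroup) : Prop :=
  ∀ (h : SurfaceGroup) (k : ℕ), 2 ≤ k → ConjClasses.mk (h ^ k) ≠ c

/-! ### The rotation system of the Cayley graph

The Cayley graph is embedded in the hyperbolic plane as the 1-skeleton of the tessellation by
octagons, eight at each vertex, oriented so that the boundary of every octagon, traversed
counterclockwise, reads the relator. Each of the eight letters occurs exactly once in the relator
and once in its inverse, so every edge (with a direction) has exactly one octagon on its left and
one on its right, and the cyclic order of the eight edges leaving a vertex is determined. -/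

/-- The same edge traversed backwards. -/
def inv (x : Letter) : Letter := (x.1, !x.2)

/-- The letter that follows `x` in the cyclic word `a b a⁻¹ b⁻¹ c d c⁻¹ d⁻¹`. -/
def next : Letter → Letter
  | (.a, true) => (.b, true)
  | (.b, true) => (.a, false)
  | (.a, false) => (.b, false)
  | (.b, false) => (.c, true)
  | (.c, true) => (.d, true)
  | (.d, true) => (.c, false)
  | (.c, false) => (.d, false)
  | (.d, false) => (.a, true)

/-- The letter that precedes `x` in the cyclic word `a b a⁻¹ b⁻¹ c d c⁻¹ d⁻¹`. -/
def prev : Letter → Letter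
  | (.a, true) => (.d, false)
  | (.b, true) => (.a, true)
  | (.a, false) => (.b, true)
  | (.b, false) => (.a, false)
  | (.c, true) => (.b, false)
  | (.d, true) => (.c, true)
  | (.c, false) => (.d, true)
  | (.d, false) => (.c, false)

/-- Among the eight edges leaving a vertex, the one immediately clockwise of the edge `y`:
arriving at the vertex along `inv y` and keeping the octagon on the left, one continues along
the letter that follows `inv y` in the relator. The counterclockwise order at a vertex is
`a, d, c⁻¹, d⁻¹, c, b, a⁻¹, b⁻¹`. -/
def clockwise (y : Letter) : Letter := next (inv y)

/-- Among the eight edges leaving a vertex, the one immediately counterclockwise of `y`. -/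
def counterclockwise (y : Letter) : Letter := inv (prev y)

/-- The edges along which one can continue after traversing the edge `x`: `turn x 1` is the one
furthest to the left, ..., `turn x 7` the one furthest to the right (and `turn x 8 = inv x`). -/
def turn (x : Letter) (k : ℕ) : Letter := clockwise^[k] (inv x)

/-- Continue after `x` along the boundary of the octagon on the right of `x`. -/
def turnRight (x : Letter) : Letter := counterclockwise (inv x)

/-! ### The Markov chain -/

/-- The side (relative to the direction of traversal) that occurs as a superscript of a state. -/
inductive Side
  | left | right
  deriving DecidableEq

instance : Fintype Side := ⟨{.left, .right}, by intro x; cases x <;> decide⟩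

/-- The states of the Markov chain. Every state stands for one step of a snake, that is, for the
label or labels of the edges traversed in that step together with the shape of the region of the
hyperbolic plane that the snake enters. In every case the letter is the label of the leftmost
edge of the step, which determines the labels of its other edges:

* `A x`, `Ap s x`, `App s x` (cases A, A', A''): the single edge `x`. The region lies beyond the
  geodesic of the dual tessellation that `x` crosses. In case A it is bounded by the crossed side
  and the geodesics continuing the two sides adjacent to it; in case A' one wedge, and in case A''
  two wedges (hence also the outermost side), are cut from it on the side `s`.
* `B x`: the two edges `x` and `clockwise x`, leaving a common vertex along the boundary of a
  common octagon, toward the wedge that lies beyond both of the geodesics they cross.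
* `C x`, `Cp x`, `D x` (cases C, C', D): the second, third and fourth edges along both halves of
  the boundary of the octagon, `x` being the edge on the left half, which has the octagon on its
  right; in case D the two edges end at a common vertex.
* `E .left x`: the three edges `x`, `y = clockwise x`, `z = prev (inv y)`, where `y` and `z` are
  the last edges on the left and right halves of an octagon, and `x` and `y` are the first edges
  on the left and right halves of the next octagon.
* `E .right x`: the three edges `x`, `y = prev (inv x)`, `z = clockwise y`, where `x` and `y` are
  the last edges on the left and right halves of an octagon, and `y` and `z` are the first edges
  on the left and right halves of the next octagon. -/
inductive MarkovState
  | A (x : Letter)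
  | Ap (s : Side) (x : Letter)
  | App (s : Side) (x : Letter)
  | B (x : Letter)
  | C (x : Letter)
  | Cp (x : Letter)
  | D (x : Letter)
  | E (s : Side) (x : Letter)
  deriving DecidableEq, Fintype

open MarkovState in
/-- The label of the leftmost edge of a step. -/
def MarkovState.leftEdge : MarkovState → Letter
  | A x => x
  | Ap _ x => x
  | App _ x => x
  | B x => x
  | C x => x
  | Cp x => x
  | D x => x
  | E _ x => x

open MarkovState in
/-- The states that can follow a given state: the next edges start where the present ones end,
and the next region is one of the pieces into which the geodesics bounding the dual octagon around
the vertex reached divide the present region.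

* In cases A and A' the region has (apart from the dual octagon itself) six wedges (B), between
  any two neighbouring edges ahead, five regions of case A, and the two outermost regions. An
  outermost region loses one wedge on its outer side (A'), two if the present region
  has already lost one on that side (A'').
* In case A'' the outermost region on the cut side is gone and so is the wedge next to it, and
  the outermost remaining one on that side is of case A.
* In case D the two incoming edges are neighbours at the vertex reached, so six edges lie ahead.
* From B one is forced along both halves of the octagon to C and C'. From there the region is
  divided into a wedge on the left (`E .left`), a wedge on the right (`E .right`) and the rest (D).
  A step E starts a new octagon, so that it is followed by C, as B is. -/
def MarkovState.successors : MarkovState → List MarkovState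
  | A x =>
      [1, 2, 3, 4, 5, 6].map (fun k => B (turn x k)) ++
      [2, 3, 4, 5, 6].map (fun k => A (turn x k)) ++
      [Ap .left (turn x 1), Ap .right (turn x 7)]
  | Ap .left x =>
      [1, 2, 3, 4, 5, 6].map (fun k => B (turn x k)) ++
      [2, 3, 4, 5, 6].map (fun k => A (turn x k)) ++
      [App .left (turn x 1), Ap .right (turn x 7)]
  | Ap .right x =>
      [1, 2, 3, 4, 5, 6].map (fun k => B (turn x k)) ++
      [2, 3, 4, 5, 6].map (fun k => A (turn x k)) ++
      [Ap .left (turn x 1), App .right (turn x 7)]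
  | App .left x =>
      [2, 3, 4, 5, 6].map (fun k => B (turn x k)) ++
      [2, 3, 4, 5, 6].map (fun k => A (turn x k)) ++
      [Ap .right (turn x 7)]
  | App .right x =>
      [1, 2, 3, 4, 5].map (fun k => B (turn x k)) ++
      [2, 3, 4, 5, 6].map (fun k => A (turn x k)) ++
      [Ap .left (turn x 1)]
  | B x => [C (turnRight x)]
  | C x => [Cp (turnRight x)]
  | Cp x =>
      [D (turnRight x), E .left (counterclockwise (turnRight x)), E .right (turnRight x)]
  | D x =>
      [1, 2, 3, 4, 5].map (fun k => B (turn x k)) ++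
      [2, 3, 4, 5].map (fun k => A (turn x k)) ++
      [Ap .left (turn x 1), Ap .right (turn x 6)]
  | E .left x => [C (turnRight x)]
  | E .right x => [C (turnRight (prev (inv x)))]

/-- The transition relation: `K` can follow `J`. -/
def Follows (J K : MarkovState) : Prop := K ∈ J.successors

/-- The elements of the (two-sided, topological) Markov chain: the bi-infinite sequences of states
with admissible transitions. -/
def chain : Set (ℤ → MarkovState) := {J | ∀ i : ℤ, Follows (J i) (J (i + 1))}

/-- The shift on bi-infinite sequences of states. -/
def shift (J : ℤ → MarkovState) : ℤ → MarkovState := fun i => J (i + 1)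

/-- The elements of the Markov chain of (least) period `n`. -/
def periodPoints (n : ℕ) : Set (ℤ → MarkovState) :=
  {J | J ∈ chain ∧ Function.minimalPeriod shift J = n}

/-- The conjugacy class of the cyclic word that is read off along the leftmost edges of the
steps `0, ..., n - 1`. -/
def readClass (n : ℕ) (J : ℤ → MarkovState) : ConjClasses SurfaceGroup :=
  ConjClasses.mk (wordValue (List.ofFn fun i : Fin n => (J (i : ℕ)).leftEdge))

/-- The primitive conjugacy classes of word length `n`. -/
def primitiveClasses (n : ℕ) : Set (ConjClasses SurfaceGroup) :=
  {c | IsPrimitiveClass c ∧ classLength c = n}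

end SurfaceChain

/-! The vertices of the tessellation are coded combinatorially by their leftmost geodesics. A path
is a list of turns; it is a leftmost geodesic when it has no backtrack `0`, no `1 1 1` (half an
octagon on the left, which can be exchanged for the other half with turns `7 7 7`), and no `7 7 7 (6
7 7)^j 7` (a chain of octagons on the right, whose other side is two edges shorter). Crossing an
edge changes such a list in one of four ways (`Cross`), and exactly one of them leads to another
admissible list. This defines an involution `across`. With the rotations about a vertex it satisfies
the octagon relation `around ^ 8 = 1`, so the surface group acts on the lists. The orbit of `base`
gives every group element its normal form (`act_eq_code`, `exists_code`), whose length is the word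
length. A periodic bi-infinite leftmost line gives a cyclic word of least length in its class.
Conversely, a class of length `n > 6` contains such a line: among its shortest cyclic words take one
with the largest turn sum (`exists_leftmost`). If the translations of two lines are conjugate,
comparing the normal forms of `u ^ k * g = g * v ^ k` shows that the lines differ by a shift
(`Leftmost.shift_of_conj`); applied to a root of a translation, this also gives primitivity. The
exceptions are the turn sequences `211211...` and `677677...`, the two sides of an infinite chain of
octagons, where a push may run on forever. Their lines have period 6, which `n > 6` excludes. It
remains to match lines with the chain. After forgetting letters, a state sequence is a sequence of
shapes along the turns of its left line. Every line so traced is leftmost (`Traces.leftmost`), and a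
leftmost periodic line other than `677677...` carries exactly one periodic sequence of shapes
(`Traces.unique`, `Leftmost.exists_traces`). Hence periodic points correspond to periodic leftmost
lines with the same least period, and a fibre of `readClass` is one shift orbit of `n` points. -/

namespace SurfaceChain

/-! ### Turn lists and octagon crossings

A path is recorded by its turns, numbered clockwise from the edge one arrives by. The last entry of
a list is never part of a pattern. -/

/-- Pushing a path across a chain of octagons, from their left side (first list) to their right
side (second list): the part of the turn lists that comes after the first turns. -/
inductive Flip : List (Fin 8) → List (Fin 8) → Prop
  | last (q : Fin 8) (r : List (Fin 8)) : Flip (q :: r) (7 :: (q - 1) :: r)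
  | step {l l' : List (Fin 8)} : Flip l l' → Flip (2 :: 1 :: 1 :: l) (6 :: 7 :: 7 :: l')

/-- A turn list starting with a backtrack, a half octagon on the left, or a shortenable chain of
octagons on the right. -/
inductive BadHead : List (Fin 8) → Prop
  | zero (q : Fin 8) (r : List (Fin 8)) : BadHead (0 :: q :: r)
  | one (q : Fin 8) (r : List (Fin 8)) : BadHead (1 :: 1 :: 1 :: q :: r)
  | seven {l l' : List (Fin 8)} : Flip l l' → BadHead (7 :: 7 :: 7 :: l')

/-- Turn lists of leftmost geodesics. -/
def Good : List (Fin 8) → Prop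
  | [] => True
  | k :: r => ¬ BadHead (k :: r) ∧ Good r

/-- The two descriptions of a path, seen from the two ends of an edge. -/
inductive Cross : List (Fin 8) → List (Fin 8) → Prop
  | cancel {s : List (Fin 8)} : s ≠ [] → Good s → Cross (0 :: s) s
  | extend {s : List (Fin 8)} : s ≠ [] → Good s → Cross s (0 :: s)
  | push {l l' : List (Fin 8)} : Flip l l' → Cross (1 :: 1 :: 1 :: l) (7 :: 7 :: 7 :: l')
  | pull {l l' : List (Fin 8)} : Flip l l' → Cross (7 :: 7 :: 7 :: l') (1 :: 1 :: 1 :: l)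

theorem Flip.length {l l' : List (Fin 8)} (h : Flip l l') : l'.length = l.length + 1 := by
  induction h with
  | last q r => simp
  | step _ ih => simp [ih]

theorem Flip.ne_nil {l l' : List (Fin 8)} (h : Flip l l') : l ≠ [] := by
  cases h <;> simp

theorem Flip.ne_nil' {l l' : List (Fin 8)} (h : Flip l l') : l' ≠ [] := by
  cases h <;> simp

theorem Flip.left_unique {l m l' : List (Fin 8)} (h : Flip l l') (h' : Flip m l') : l = m := by
  induction h generalizing m with
  | last q r =>
    generalize hk : q - 1 = k at h'
    cases h' with
    | last q' r' => rw [sub_left_injective hk]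
  | step _ ih =>
    cases h' with
    | step h' => rw [ih h']

theorem badHead_zero_iff {r : List (Fin 8)} : BadHead (0 :: r) ↔ r ≠ [] := by
  constructor
  · intro h; cases h; simp
  · intro h
    obtain ⟨q, r, rfl⟩ := List.exists_cons_of_ne_nil h
    exact .zero q r

theorem badHead_one_iff {r : List (Fin 8)} :
    BadHead (1 :: r) ↔ ∃ t, t ≠ [] ∧ r = 1 :: 1 :: t := by
  constructor
  · intro h; cases h with
    | one q r => exact ⟨q :: r, by simp, rfl⟩
  · rintro ⟨t, ht, rfl⟩
    obtain ⟨q, r, rfl⟩ := List.exists_cons_of_ne_nil ht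
    exact .one q r

theorem badHead_seven_iff {r : List (Fin 8)} :
    BadHead (7 :: r) ↔ ∃ l l', Flip l l' ∧ r = 7 :: 7 :: l' := by
  constructor
  · intro h; cases h with
    | seven h => exact ⟨_, _, h, rfl⟩
  · rintro ⟨l, l', h, rfl⟩
    exact .seven h

theorem not_badHead {k : Fin 8} {r : List (Fin 8)} (h0 : k ≠ 0) (h1 : k ≠ 1) (h7 : k ≠ 7) :
    ¬ BadHead (k :: r) := by
  intro h; cases h <;> simp_all

theorem flip_seven (t : List (Fin 8)) (ht : t ≠ []) : ∃ l, Flip l (7 :: t) := by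
  obtain ⟨q, r, rfl⟩ := List.exists_cons_of_ne_nil ht
  refine ⟨(q + 1) :: r, ?_⟩
  have := Flip.last (q + 1) r
  rwa [add_sub_cancel_right] at this

theorem Good.tail {k : Fin 8} {r : List (Fin 8)} (h : Good (k :: r)) : Good r := h.2

theorem good_singleton (k : Fin 8) : Good [k] := by
  refine ⟨fun h => ?_, trivial⟩
  cases h

theorem good_cons_of_ne {k : Fin 8} {r : List (Fin 8)} (h0 : k ≠ 0) (h1 : k ≠ 1) (h7 : k ≠ 7)
    (hr : Good r) : Good (k :: r) := ⟨not_badHead h0 h1 h7, hr⟩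

/-- A push does not create new patterns, provided that it is carried through. -/
theorem Good.exists_flip : ∀ {l : List (Fin 8)}, Good l → l ≠ [] →
    (∀ t, t ≠ [] → l ≠ 1 :: t) → ∃ l', Flip l l' ∧ Good (7 :: 7 :: l')
  | q :: r, hl, _, h1 => by
    -- Pushing over one octagon lowers the next turn by one; `2 1 1` would thus become a new half
    -- octagon `1 1 1`, and the push has to go on. In every other case it stops.
    by_cases hc : q = 2 ∧ ∃ m, m ≠ [] ∧ r = 1 :: 1 :: m
    · obtain ⟨rfl, m, hm, rfl⟩ := hc
      obtain ⟨m', hf, hg⟩ := Good.exists_flip (l := m) hl.tail.tail.tail hm (by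
        rintro t ht rfl
        exact hl.tail.1 (badHead_one_iff.2 ⟨t, ht, rfl⟩))
      refine ⟨_, hf.step, ?_, ?_, good_cons_of_ne (by decide) (by decide) (by decide) hg⟩
      · rw [badHead_seven_iff]
        rintro ⟨_, _, h, he⟩
        simp at he
      · rw [badHead_seven_iff]
        rintro ⟨_, _, h, he⟩
        simp at he
    · have hq0 : r ≠ [] → q ≠ 0 := by
        rintro hr rfl
        exact hl.1 (badHead_zero_iff.2 hr)
      have hq1 : r ≠ [] → q ≠ 1 := by
        rintro hr rfl
        exact h1 r hr rfl
      have h7 : r ≠ [] → q - 1 ≠ 7 := fun hr h => hq0 hr (by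
        rw [sub_eq_iff_eq_add] at h; rw [h]; decide)
      have g0 : Good ((q - 1) :: r) := by
        refine ⟨?_, hl.tail⟩
        rcases eq_or_ne r [] with rfl | hr
        · exact (good_singleton _).1
        intro hb
        generalize he : q - 1 = k at hb h7
        have hk : q = k + 1 := by rw [← he, sub_add_cancel]
        cases hb with
        | zero => exact hq1 hr (by simp [hk])
        | one a b => exact hc ⟨by rw [hk]; decide, _, by simp, rfl⟩
        | seven => exact h7 (by simp) rfl
      have key : ∀ m, BadHead (7 :: (q - 1) :: m) → m = r → False := by
        rintro m hb rfl
        obtain ⟨l, l', hf, he⟩ := badHead_seven_iff.1 hb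
        simp only [List.cons.injEq] at he
        exact h7 (by simp [he.2]) he.1
      have g1 : Good (7 :: (q - 1) :: r) := ⟨fun h => key _ h rfl, g0⟩
      refine ⟨_, .last q r, ?_, ?_, g1⟩
      · rw [badHead_seven_iff]
        rintro ⟨l, l', hf, he⟩
        simp only [List.cons.injEq, true_and] at he
        subst he
        generalize hk : q - 1 = k at hf
        have hk : q = k + 1 := by rw [← hk, sub_add_cancel]
        cases hf with
        | last => exact hq0 (by simp) (by rw [hk]; decide)
        | step hf =>
          exact hl.1 (by rw [hk]; exact BadHead.seven hf)
      · rw [badHead_seven_iff]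
        rintro ⟨l, l', hf, he⟩
        simp only [List.cons.injEq, true_and] at he
        obtain ⟨he, rfl⟩ := he
        exact h7 hf.ne_nil' he

/-- Pulling a chain back does not create new patterns. -/
theorem Flip.good {l l' : List (Fin 8)} (h : Flip l l') (hg : Good (7 :: 7 :: l')) :
    Good (1 :: 1 :: l) := by
  induction h with
  | last q r =>
    have hq0 : r ≠ [] → q ≠ 0 := by
      rintro hr rfl
      obtain ⟨l, hl⟩ := flip_seven r hr
      exact hg.1 (.seven hl)
    have hq1 : r ≠ [] → q ≠ 1 := by
      rintro hr rfl
      exact hg.tail.tail.tail.1 (badHead_zero_iff.2 hr)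
    refine ⟨?_, ?_, ?_, hg.tail.tail.tail.tail⟩
    · rw [badHead_one_iff]
      rintro ⟨t, ht, he⟩
      simp only [List.cons.injEq, true_and] at he
      exact hq1 (he.2 ▸ ht) he.1
    · rw [badHead_one_iff]
      rintro ⟨t, ht, he⟩
      simp only [List.cons.injEq] at he
      exact hq1 (by simp [he.2]) he.1
    · intro hb
      cases hb with
      | zero => exact hq0 (by simp) rfl
      | one => exact hq1 (by simp) rfl
      | seven hf => exact hg.1 (.seven hf.step)
  | step h ih =>
    have := ih hg.tail.tail.tail
    refine ⟨?_, ?_, good_cons_of_ne (by decide) (by decide) (by decide) this⟩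
    · rw [badHead_one_iff]
      rintro ⟨t, ht, he⟩
      simp at he
    · rw [badHead_one_iff]
      rintro ⟨t, ht, he⟩
      simp at he

theorem Cross.symm {s t : List (Fin 8)} (h : Cross s t) : Cross t s := by
  cases h with
  | cancel h h' => exact .extend h h'
  | extend h h' => exact .cancel h h'
  | push h => exact .pull h
  | pull h => exact .push h

/-- The only choice in a push is to stop or to go on at `2 1 1`; stopping there leaves `1 1 1`,
which goodness forbids. -/
theorem Flip.right_unique {l m m' : List (Fin 8)} (h : Flip l m) (h' : Flip l m')
    (hm : Good m) (hm' : Good m') : m = m' := by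
  induction h generalizing m' with
  | last q r =>
    cases h' with
    | last q r => rfl
    | step h' =>
      obtain ⟨a, b, rfl⟩ := List.exists_cons_of_ne_nil h'.ne_nil
      exact absurd (BadHead.one a b) hm.tail.1
  | step h ih =>
    cases h' with
    | last =>
      obtain ⟨a, b, rfl⟩ := List.exists_cons_of_ne_nil h.ne_nil
      exact absurd (BadHead.one a b) hm'.tail.1
    | step h' => rw [ih h' hm.tail.tail.tail hm'.tail.tail.tail]

/-- The list `s` decides the kind of crossing: `extend` needs `s` good, and the other three
correspond to the three kinds of `BadHead`. -/
theorem Cross.unique {s t t' : List (Fin 8)} (h : Cross s t) (h' : Cross s t')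
    (ht : Good t.tail) (ht' : Good t'.tail) : t = t' := by
  cases h with
  | cancel h1 h2 =>
    cases h' with
    | cancel => rfl
    | extend h3 h4 => exact absurd (badHead_zero_iff.2 h1) h4.1
  | extend h1 h2 =>
    cases h' with
    | cancel h3 h4 => exact absurd (badHead_zero_iff.2 h3) h2.1
    | extend => rfl
    | push h =>
      obtain ⟨a, b, rfl⟩ := List.exists_cons_of_ne_nil h.ne_nil
      exact absurd (BadHead.one a b) h2.1
    | pull h => exact absurd (BadHead.seven h) h2.1
  | push h =>
    cases h' with
    | extend h3 h4 =>
      obtain ⟨a, b, rfl⟩ := List.exists_cons_of_ne_nil h.ne_nil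
      exact absurd (BadHead.one a b) h4.1
    | push h' => rw [h.right_unique h' ht.tail.tail ht'.tail.tail]
  | pull h =>
    cases h' with
    | extend h3 h4 => exact absurd (BadHead.seven h) h4.1
    | pull h' => rw [h.left_unique h']

theorem Cross.exists {s : List (Fin 8)} (hs : s ≠ []) (hg : Good s.tail) :
    ∃ t, Cross s t ∧ t ≠ [] ∧ Good t.tail := by
  by_cases h : Good s
  · exact ⟨_, .extend hs h, by simp, h⟩
  obtain ⟨k, r, rfl⟩ := List.exists_cons_of_ne_nil hs
  have hb : BadHead (k :: r) := by
    by_contra hb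
    exact h ⟨hb, hg⟩
  cases hb with
  | zero q r => exact ⟨_, .cancel (by simp) hg, by simp, Good.tail hg⟩
  | one q r =>
    have hg' : Good (1 :: 1 :: q :: r) := hg
    obtain ⟨l', hl, hgl⟩ := hg'.tail.tail.exists_flip (by simp) (by
      rintro t ht he
      rw [he] at hg'
      exact hg'.1 (badHead_one_iff.2 ⟨t, ht, rfl⟩))
    exact ⟨_, .push hl, by simp, hgl⟩
  | seven hf => exact ⟨_, .pull hf, by simp, hf.good hg⟩

/-! ### The crossing involution and the octagon relation. -/

/-- The vertices, seen from a directed edge. -/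
abbrev Dart : Type := {s : List (Fin 8) // s ≠ [] ∧ Good s.tail}

theorem Dart.existsUnique_cross (s : Dart) : ∃! t : Dart, Cross s.1 t.1 := by
  obtain ⟨t, h, ht⟩ := Cross.exists s.2.1 s.2.2
  exact ⟨⟨t, ht⟩, h, fun t' h' => Subtype.ext (h'.unique h t'.2.2 ht.2)⟩

/-- Passing to the other end of the reference edge. -/
noncomputable def Dart.flipFun (s : Dart) : Dart := s.existsUnique_cross.choose

theorem Dart.cross_flipFun (s : Dart) : Cross s.1 s.flipFun.1 :=
  s.existsUnique_cross.choose_spec.1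

theorem Dart.flipFun_eq {s t : Dart} (h : Cross s.1 t.1) : s.flipFun = t :=
  (s.existsUnique_cross.choose_spec.2 t h).symm

/-- Passing to the other end of the reference edge, as a permutation. -/
noncomputable def Dart.across : Equiv.Perm Dart where
  toFun := Dart.flipFun
  invFun := Dart.flipFun
  left_inv s := Dart.flipFun_eq s.cross_flipFun.symm
  right_inv s := Dart.flipFun_eq s.cross_flipFun.symm

theorem Dart.cross_across (s : Dart) : Cross s.1 (Dart.across s).1 := s.cross_flipFun

theorem Dart.across_eq {s t : Dart} (h : Cross s.1 t.1) : Dart.across s = t := Dart.flipFun_eq h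

theorem Dart.across_across (s : Dart) : Dart.across (Dart.across s) = s :=
  Dart.across_eq s.cross_across.symm

/-- Adding `c` to the first entry. -/
def addHead (c : Fin 8) : List (Fin 8) → List (Fin 8)
  | [] => []
  | k :: r => (k + c) :: r

@[simp] theorem addHead_cons (c k : Fin 8) (r : List (Fin 8)) :
    addHead c (k :: r) = (k + c) :: r := rfl

theorem addHead_addHead (c d : Fin 8) (s : List (Fin 8)) :
    addHead c (addHead d s) = addHead (d + c) s := by
  cases s <;> simp [addHead, add_assoc]

theorem addHead_zero (s : List (Fin 8)) : addHead 0 s = s := by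
  cases s <;> simp [addHead]

@[simp] theorem tail_addHead (c : Fin 8) (s : List (Fin 8)) : (addHead c s).tail = s.tail := by
  cases s <;> rfl

@[simp] theorem length_addHead (c : Fin 8) (s : List (Fin 8)) :
    (addHead c s).length = s.length := by
  cases s <;> rfl

theorem addHead_ne_nil {c : Fin 8} {s : List (Fin 8)} (h : s ≠ []) : addHead c s ≠ [] := by
  cases s <;> simp_all [addHead]

/-- Turning the reference edge. -/
def Dart.rot (c : Fin 8) : Equiv.Perm Dart where
  toFun s := ⟨addHead c s.1, addHead_ne_nil s.2.1, by simpa using s.2.2⟩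
  invFun s := ⟨addHead (-c) s.1, addHead_ne_nil s.2.1, by simpa using s.2.2⟩
  left_inv s := Subtype.ext (by simp [addHead_addHead, addHead_zero])
  right_inv s := Subtype.ext (by simp [addHead_addHead, addHead_zero])

@[simp] theorem Dart.val_rot (c : Fin 8) (s : Dart) : (Dart.rot c s).1 = addHead c s.1 := rfl

theorem Dart.rot_add (c d : Fin 8) : Dart.rot (c + d) = Dart.rot c * Dart.rot d := by
  ext s : 2
  simp [addHead_addHead, add_comm]

theorem Dart.rot_zero : Dart.rot 0 = 1 := by
  ext s : 2
  simp [addHead_zero]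

/-- Walking around an octagon. -/
noncomputable def Dart.around : Equiv.Perm Dart := Dart.across * Dart.rot 1

theorem Dart.around_eq {s t : Dart} {k : Fin 8} {r : List (Fin 8)} (hs : s.1 = k :: r)
    (h : Cross ((k + 1) :: r) t.1) : Dart.around s = t :=
  Dart.across_eq (by simpa [hs] using h)

theorem Dart.around_eq_of_good {s : Dart} {k : Fin 8} {r : List (Fin 8)} (hs : s.1 = k :: r)
    (h : Good ((k + 1) :: r)) : (Dart.around s).1 = 0 :: (k + 1) :: r := by
  rw [Dart.around_eq (t := ⟨0 :: (k + 1) :: r, by simp, h⟩) hs (.extend (by simp) h)]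

theorem Dart.around_eq_of_seven {s : Dart} {r : List (Fin 8)} (hs : s.1 = 7 :: r)
    (h : r ≠ []) : (Dart.around s).1 = r := by
  have hg : Good r := by simpa [hs] using s.2.2
  rw [Dart.around_eq (t := ⟨r, h, ?_⟩) hs (.cancel h hg)]
  cases r with
  | nil => trivial
  | cons => exact hg.tail

/-- The eight steps around the octagon can be followed explicitly: three extensions, a push to the
other half, three cancellations, and a last step that cancels or, if the push crossed several
octagons, pulls the remaining ones back. -/
theorem Dart.around_pow_of_good {s : Dart} {m : Fin 8} {r : List (Fin 8)} (hs : s.1 = m :: r)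
    (h : Good ((m + 1) :: r)) (h1 : m = 0 → r = []) : (Dart.around ^ 8) s = s := by
  have h1' : r ≠ [] → m + 1 ≠ 1 := by
    intro hr h
    exact hr (h1 (by simpa using h))
  have e1 := Dart.around_eq_of_good hs h
  have g2 : Good (1 :: (m + 1) :: r) := by
    refine ⟨?_, h⟩
    rw [badHead_one_iff]
    rintro ⟨t, ht, he⟩
    simp only [List.cons.injEq] at he
    exact h1' (by simp [he.2]) he.1
  have e2 := Dart.around_eq_of_good e1 g2
  have g3 : Good (1 :: 1 :: (m + 1) :: r) := by
    refine ⟨?_, g2⟩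
    rw [badHead_one_iff]
    rintro ⟨t, ht, he⟩
    simp only [List.cons.injEq, true_and] at he
    exact h1' (he.2 ▸ ht) he.1
  have e3 := Dart.around_eq_of_good e2 g3
  obtain ⟨l', hf, hg⟩ := h.exists_flip (by simp) (by
    rintro t ht he
    simp only [List.cons.injEq] at he
    exact h1' (he.2 ▸ ht) he.1)
  have e4 : (Dart.around (Dart.around (Dart.around (Dart.around s)))).1
      = 7 :: 7 :: 7 :: l' := by
    rw [Dart.around_eq (t := ⟨7 :: 7 :: 7 :: l', by simp, hg⟩) e3 (.push hf)]
  have e5 := Dart.around_eq_of_seven e4 (by simp)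
  have e6 := Dart.around_eq_of_seven e5 (by simp)
  have e7 := Dart.around_eq_of_seven e6 hf.ne_nil'
  apply Subtype.ext
  change (Dart.around (Dart.around (Dart.around (Dart.around (Dart.around (Dart.around
    (Dart.around (Dart.around s)))))))).1 = s.1
  generalize hk : m + 1 = k at hf
  cases hf with
  | last =>
    rw [Dart.around_eq_of_seven e7 (by simp), hs, ← hk]
    simp
  | @step l l' hf =>
    have g : Good (1 :: 1 :: l) := hf.good hg.tail.tail.tail
    rw [Dart.around_eq (t := ⟨1 :: 1 :: 1 :: l, by simp, g⟩) e7 (.pull hf), hs,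
      eq_sub_of_add_eq hk]
    rfl

theorem Dart.around_pow : Dart.around ^ 8 = 1 := by
  suffices ∀ n, ∀ s : Dart, s.1.length = n → (Dart.around ^ 8) s = s by
    ext s : 1
    exact this _ s rfl
  intro n
  induction n using Nat.strong_induction_on with
  | _ n ih =>
  rintro s rfl
  -- `around ^ 8` commutes with `around`, so it fixes a dart as soon as it fixes the next one of the
  -- same octagon.
  have forward : (Dart.around s).1.length < s.1.length → (Dart.around ^ 8) s = s := by
    intro hlt
    have := ih _ hlt _ rfl
    apply Dart.around.injective
    rw [← Equiv.Perm.mul_apply, ← pow_succ', pow_succ, Equiv.Perm.mul_apply, this]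
  obtain ⟨m, r, hs⟩ := List.exists_cons_of_ne_nil s.2.1
  have hr : Good r := by simpa [hs] using s.2.2
  -- If the path starts along the reference edge, the previous dart of the octagon has a shorter
  -- list; if `(m + 1) :: r` is not good, the next one has. Otherwise the walk can be followed
  -- explicitly.
  by_cases h0 : m = 0 ∧ r ≠ []
  · obtain ⟨rfl, hne⟩ := h0
    have hr' : Good r.tail := by
      cases r with
      | nil => trivial
      | cons => exact hr.tail
    let t : Dart := Dart.rot (-1) ⟨r, hne, hr'⟩
    have ht : Dart.around t = s := by
      have : Dart.rot 1 t = ⟨r, hne, hr'⟩ := by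
        simp only [t]
        rw [← Equiv.Perm.mul_apply, ← Dart.rot_add]
        simp [Dart.rot_zero]
      rw [Dart.around, Equiv.Perm.mul_apply, this]
      apply Dart.across_eq
      rw [hs]
      exact .extend hne hr
    have := ih t.1.length (by simp [t, hs]) t rfl
    rw [← ht, ← Equiv.Perm.mul_apply, ← pow_succ, pow_succ', Equiv.Perm.mul_apply, this]
  · by_cases hg : Good ((m + 1) :: r)
    · refine Dart.around_pow_of_good hs hg fun h => ?_
      by_contra hne
      exact h0 ⟨h, hne⟩
    · have hb : BadHead ((m + 1) :: r) := by
        by_contra hb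
        exact hg ⟨hb, hr⟩
      generalize hk : m + 1 = k at hb
      have hm : m = k - 1 := eq_sub_of_add_eq hk
      cases hb with
      | zero =>
        apply forward
        rw [Dart.around_eq_of_seven (r := _ :: _) (by rw [hs, hm]; rfl) (by simp)]
        simp [hs]
      | one => simp [hm] at h0
      | @seven l l' hf =>
        apply forward
        rw [Dart.around_eq (t := ⟨1 :: 1 :: 1 :: l, by simp, hf.good hr⟩) hs
          (by rw [hk]; exact .pull hf)]
        simp [hs, hf.length]

/-! ### Words and their values -/

@[simp] theorem wordValue_nil : wordValue [] = 1 := by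
  rw [wordValue, ← FreeGroup.one_eq_mk, map_one]

theorem wordValue_append (v w : List Letter) :
    wordValue (v ++ w) = wordValue v * wordValue w := by
  rw [wordValue, ← FreeGroup.mul_mk, map_mul]; rfl

theorem wordValue_cons (x : Letter) (w : List Letter) :
    wordValue (x :: w) = wordValue [x] * wordValue w := wordValue_append [x] w

theorem wordValue_inv (x : Letter) : wordValue [inv x] = (wordValue [x])⁻¹ := by
  rw [wordValue, wordValue, ← map_inv, FreeGroup.inv_mk]
  rfl

theorem wordValue_map_inv (w : List Letter) :
    wordValue (w.map inv).reverse = (wordValue w)⁻¹ := by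
  induction w with
  | nil => simp
  | cons x w ih =>
    rw [List.map_cons, List.reverse_cons, wordValue_append, ih, wordValue_inv, wordValue_cons x w,
      mul_inv_rev]

theorem wordValue_relator : wordValue relator = 1 :=
  PresentedGroup.one_of_mem (Set.mem_singleton _)

theorem wordValue_rotate (w : List Letter) (hw : wordValue w = 1) (i : ℕ) :
    wordValue (w.rotate i) = 1 := by
  induction i with
  | zero => simpa using hw
  | succ i ih =>
    rw [← List.rotate_rotate]
    generalize w.rotate i = v at ih
    cases v with
    | nil => simp
    | cons x v =>
      rw [List.rotate_cons_succ, List.rotate_zero, wordValue_append]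
      rw [wordValue_cons] at ih
      exact mul_eq_one_comm.1 ih

theorem wordValue_surjective (g : SurfaceGroup) : ∃ w, wordValue w = g := by
  obtain ⟨f, rfl⟩ := PresentedGroup.mk_surjective _ g
  exact ⟨f.toWord, by rw [wordValue, FreeGroup.mk_toWord]⟩

/-! ### Directions -/

/-- The position of a letter in the clockwise order of the edges leaving a vertex. -/
def pos : Letter → Fin 8
  | (.a, true) => 0
  | (.b, false) => 1
  | (.a, false) => 2
  | (.b, true) => 3
  | (.c, true) => 4
  | (.d, false) => 5
  | (.c, false) => 6
  | (.d, true) => 7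

/-- The letter at a given position. -/
def ltr : Fin 8 → Letter :=
  ![(.a, true), (.b, false), (.a, false), (.b, true), (.c, true), (.d, false), (.c, false),
    (.d, true)]

/-- The position, at the end of an edge, of the edge traversed backwards. -/
def opp (d : Fin 8) : Fin 8 := pos (inv (ltr d))

@[simp] theorem ltr_pos (x : Letter) : ltr (pos x) = x := by
  revert x; decide

@[simp] theorem pos_ltr (d : Fin 8) : pos (ltr d) = d := by
  revert d; decide

theorem pos_injective : Function.Injective pos := Function.LeftInverse.injective ltr_pos

@[simp] theorem inv_inv (x : Letter) : inv (inv x) = x := by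
  simp [inv]

theorem ltr_opp (d : Fin 8) : ltr (opp d) = inv (ltr d) := by simp [opp]

@[simp] theorem opp_opp (d : Fin 8) : opp (opp d) = d := by simp [opp]

theorem pos_inv (x : Letter) : pos (inv x) = opp (pos x) := by simp [opp]

/-! ### The action of the group on the vertices -/

/-- The effect of prepending the edge `x` to a path. -/
noncomputable def prepend (x : Letter) : Equiv.Perm Dart :=
  Dart.rot (pos x) * Dart.across * Dart.rot (-(pos (inv x)))

theorem prepend_inv (x : Letter) : prepend (inv x) = (prepend x)⁻¹ := by
  rw [eq_inv_iff_mul_eq_one]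
  ext s : 1
  simp only [prepend, inv_inv, Equiv.Perm.mul_apply]
  rw [← Equiv.Perm.mul_apply (Dart.rot (-(pos x))), ← Dart.rot_add, neg_add_cancel,
    Dart.rot_zero, Equiv.Perm.one_apply, Dart.across_across, ← Equiv.Perm.mul_apply,
    ← Dart.rot_add]
  simp [Dart.rot_zero]

theorem lift_prepend (w : List Letter) :
    FreeGroup.lift (fun g => prepend (g, true)) (FreeGroup.mk w) = (w.map prepend).prod := by
  rw [FreeGroup.lift_mk]
  congr 2
  ext1 ⟨g, b⟩
  cases b
  · exact (prepend_inv (g, true)).symm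
  · rfl

/-- Since `next x` lies one position clockwise of `inv x`, the rotations of neighbouring factors
combine to `rot 1`, and the product telescopes to `around ^ 8`. -/
theorem prod_prepend_relator : (relator.map prepend).prod = 1 := by
  have key : ∀ x y : Letter, y = next x → ∀ P : Equiv.Perm Dart,
      prepend x * (Dart.rot (pos y) * P) = Dart.rot (pos x) * (Dart.around * P) := by
    intro x y h P
    have : pos y = pos (inv x) + 1 := by subst h; revert x; decide
    rw [prepend, Dart.around, this, Dart.rot_add]
    have h1 : Dart.rot (-(pos (inv x))) * Dart.rot (pos (inv x)) = 1 := by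
      rw [← Dart.rot_add, neg_add_cancel, Dart.rot_zero]
    simp only [mul_assoc]
    rw [← mul_assoc (Dart.rot (-(pos (inv x)))), h1, one_mul]
  have last : prepend (.d, false) = Dart.rot (pos (.d, false)) * (Dart.around * 1) := by
    rw [prepend, mul_one, Dart.around, mul_assoc]
    rfl
  simp only [relator, List.map_cons, List.map_nil, List.prod_cons, List.prod_nil, mul_one]
  rw [last, key (.c, false) (.d, false) rfl, key (.d, true) (.c, false) rfl,
    key (.c, true) (.d, true) rfl, key (.b, false) (.c, true) rfl, key (.a, false) (.b, false) rfl,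
    key (.b, true) (.a, false) rfl, key (.a, true) (.b, true) rfl,
    show pos (.a, true) = 0 from rfl, Dart.rot_zero, one_mul]
  exact Dart.around_pow

/-- The action of the group on the vertices. -/
noncomputable def act : SurfaceGroup →* Equiv.Perm Dart :=
  PresentedGroup.toGroup (f := fun g => prepend (g, true)) (by
    rintro r rfl
    rw [lift_prepend, prod_prepend_relator])

theorem act_wordValue (w : List Letter) : act (wordValue w) = (w.map prepend).prod := by
  rw [← lift_prepend]
  rfl

theorem act_letter (x : Letter) : act (wordValue [x]) = prepend x := by
  rw [act_wordValue]; simp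

theorem act_cons (x : Letter) (w : List Letter) :
    act (wordValue (x :: w)) = prepend x * act (wordValue w) := by
  rw [wordValue_cons, map_mul, act_letter]

/-- The position of the base point: only the spike is left. -/
def base : Dart := ⟨[0], by simp, trivial⟩

/-- The code of a word: its first direction and its turns, the last one into the spike. -/
def code : List Letter → List (Fin 8)
  | [] => [0]
  | x :: w => pos x :: addHead (-(pos (inv x))) (code w)

theorem code_ne_nil (w : List Letter) : code w ≠ [] := by
  cases w <;> simp [code]

@[simp] theorem length_code (w : List Letter) : (code w).length = w.length + 1 := by
  induction w with
  | nil => rfl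
  | cons x w ih => simp [code, ih]

theorem cross_prepend (x : Letter) (s : Dart) :
    Cross (addHead (-(pos (inv x))) s.1) (addHead (-(pos x)) (prepend x s).1) := by
  have := Dart.cross_across (Dart.rot (-(pos (inv x))) s)
  simpa [prepend, addHead_addHead, addHead_zero] using this

theorem prepend_eq {x : Letter} {s t : Dart}
    (h : Cross (addHead (-(pos (inv x))) s.1) (addHead (-(pos x)) t.1)) : prepend x s = t := by
  have : Dart.across (Dart.rot (-(pos (inv x))) s) = Dart.rot (-(pos x)) t := Dart.across_eq h
  rw [prepend, Equiv.Perm.mul_apply, Equiv.Perm.mul_apply, this, ← Equiv.Perm.mul_apply,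
    ← Dart.rot_add, add_neg_cancel, Dart.rot_zero, Equiv.Perm.one_apply]

/-- Along a leftmost geodesic every letter is prepended by an `extend`, so nothing interacts. -/
theorem act_eq_code {w : List Letter} (h : Good (code w).tail) :
    (act (wordValue w) base).1 = code w := by
  induction w with
  | nil => simp [base, code]
  | cons x w ih =>
    have h' : Good (addHead (-(pos (inv x))) (code w)) := h
    have hw : Good (code w).tail := by
      obtain ⟨k, r, hk⟩ := List.exists_cons_of_ne_nil (code_ne_nil w)
      rw [hk] at h' ⊢
      exact h'.tail
    rw [act_cons, Equiv.Perm.mul_apply,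
      prepend_eq (t := ⟨code (x :: w), code_ne_nil _, h⟩)]
    rw [ih hw]
    simpa [code] using Cross.extend (addHead_ne_nil (code_ne_nil w)) h'

/-! ### Paths in the group -/

/-- The word spelled by a path with given first direction and turns. -/
def spell : Fin 8 → List (Fin 8) → List Letter
  | _, [] => []
  | d, k :: r => ltr d :: spell (opp d + k) r

/-- The last direction of a path with given first direction and turns. -/
def endDir : Fin 8 → List (Fin 8) → Fin 8
  | d, [] => d
  | d, k :: r => endDir (opp d + k) r

theorem code_spell {d : Fin 8} {l : List (Fin 8)} (h : endDir d l = 0) :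
    code (spell d l) = d :: l := by
  induction l generalizing d with
  | nil => simp_all [spell, endDir, code]
  | cons k r ih =>
    rw [spell, code, ih h]
    simp [pos_inv]

theorem octagon (d : Fin 8) :
    wordValue (spell d [1, 1, 1, 0]) = wordValue (spell (d - 1) [7, 7, 7, 0]) := by
  -- One half of the octagon followed by the other half backwards is its whole boundary.
  have : ∃ i : Fin 8, spell d [1, 1, 1, 0] ++ ((spell (d - 1) [7, 7, 7, 0]).map inv).reverse =
      relator.rotate i := by
    revert d; decide
  obtain ⟨i, hi⟩ := this
  rw [← mul_inv_eq_one, ← wordValue_map_inv, ← wordValue_append, hi]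
  exact wordValue_rotate _ wordValue_relator i

theorem octagon_end (d : Fin 8) :
    opp (opp (opp (opp d + 1) + 1) + 1) = opp (opp (opp (opp (d - 1) + 7) + 7) + 7) - 1 := by
  revert d; decide

theorem Flip.spell {l l' : List (Fin 8)} (h : Flip l l') (d : Fin 8) :
    wordValue (spell (d - 1) (7 :: 7 :: l')) = wordValue (spell d (1 :: 1 :: 1 :: l)) ∧
      endDir (d - 1) (7 :: 7 :: l') = endDir d (1 :: 1 :: 1 :: l) := by
  have main : ∀ (d q : Fin 8) (r : List (Fin 8)),
      wordValue (SurfaceChain.spell (d - 1) (7 :: 7 :: 7 :: (q - 1) :: r)) =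
        wordValue (SurfaceChain.spell d (1 :: 1 :: 1 :: q :: r)) ∧
      endDir (d - 1) (7 :: 7 :: 7 :: (q - 1) :: r) = endDir d (1 :: 1 :: 1 :: q :: r) := by
    intro d q r
    have he : opp (opp (opp (opp (d - 1) + 7) + 7) + 7) + (q - 1) =
        opp (opp (opp (opp d + 1) + 1) + 1) + q := by
      rw [octagon_end]; abel
    constructor
    · have h1 : ∀ (e k₁ k₂ k₃ k₄ : Fin 8), SurfaceChain.spell e (k₁ :: k₂ :: k₃ :: k₄ :: r) =
          SurfaceChain.spell e [k₁, k₂, k₃, 0] ++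
            SurfaceChain.spell (opp (opp (opp (opp e + k₁) + k₂) + k₃) + k₄) r := by
        intros; rfl
      rw [h1, h1, wordValue_append, wordValue_append, octagon, he]
    · simp only [endDir, he]
  induction h generalizing d with
  | last q r => exact main d q r
  | @step l l' h ih =>
    have h2 := main d 2 (1 :: 1 :: l)
    rw [← h2.1, ← h2.2]
    have := ih (opp (opp (opp (d - 1) + 7) + 7) + 7)
    constructor
    · have h3 : ∀ (m : List (Fin 8)) (k : Fin 8),
          wordValue (SurfaceChain.spell (d - 1) (7 :: 7 :: k :: m)) =
          wordValue (SurfaceChain.spell (d - 1) [7, 7, 0]) *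
            wordValue (SurfaceChain.spell (opp (opp (opp (d - 1) + 7) + 7) + k) m) := by
        intros; rw [← wordValue_append]; rfl
      rw [h3 _ 6, show (2 - 1 : Fin 8) = 1 from rfl, h3 _ 7, ← this.1, add_sub_assoc]
      rfl
    · rw [show (2 - 1 : Fin 8) = 1 from rfl]
      simp only [endDir] at this ⊢
      rw [← this.2, add_sub_assoc]
      rfl

/-- Soundness of crossings: the two lists describe paths from the two ends of the edge `d` to the
same framed vertex, because the halves of an octagon are equal in the group. -/
theorem Cross.spell {k k' : Fin 8} {r r' : List (Fin 8)} (h : Cross (k :: r) (k' :: r'))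
    (d : Fin 8) :
    wordValue (spell (d + k') r') = wordValue [ltr d] * wordValue (spell (opp d + k) r) ∧
      endDir (d + k') r' = endDir (opp d + k) r := by
  cases h with
  | cancel h1 h2 =>
    simp only [SurfaceChain.spell, endDir, add_zero, opp_opp, and_true]
    rw [wordValue_cons (ltr (opp d)), ltr_opp, wordValue_inv, mul_inv_cancel_left]
  | extend h1 h2 =>
    simp only [SurfaceChain.spell, endDir, add_zero, and_true]
    rw [wordValue_cons]
  | @push l l' h =>
    have := h.spell d
    rw [show d + 7 = d - 1 by rw [sub_eq_add_neg]; rfl, this.1, this.2, ← wordValue_cons]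
    exact ⟨rfl, rfl⟩
  | @pull l l' h =>
    have := h.spell (opp d)
    rw [show opp d + 7 = opp d - 1 by rw [sub_eq_add_neg]; rfl, this.1, this.2]
    simp only [SurfaceChain.spell, endDir, opp_opp, and_true]
    rw [wordValue_cons (ltr (opp d)), ltr_opp, wordValue_inv, mul_inv_cancel_left]

/-- The normal form of `g` spells `g` again; hence its length is attained by a word. -/
theorem exists_code (g : SurfaceGroup) :
    ∃ w, wordValue w = g ∧ (act g base).1 = code w := by
  obtain ⟨w, rfl⟩ := wordValue_surjective g
  induction w with
  | nil => exact ⟨[], rfl, by simp [base, code]⟩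
  | cons x w ih =>
    obtain ⟨v, hv, hc⟩ := ih
    have h := cross_prepend x (act (wordValue w) base)
    rw [← Equiv.Perm.mul_apply, ← act_cons, hc] at h
    generalize act (wordValue (x :: w)) base = s at h
    obtain ⟨k, r, hk⟩ := List.exists_cons_of_ne_nil (code_ne_nil v)
    obtain ⟨d, l, hd⟩ := List.exists_cons_of_ne_nil s.2.1
    rw [hk, hd] at h
    have h2 := Cross.spell h (pos x)
    -- `spell` inverts `code`, and the path ends in the direction `0` of the spike.
    have hs : ∀ (v : List Letter) (k : Fin 8) (r : List (Fin 8)), code v = k :: r →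
        spell k r = v ∧ endDir k r = 0 := by
      intro v
      induction v with
      | nil =>
          intro k r h
          simp only [code, List.cons.injEq] at h
          obtain ⟨rfl, rfl⟩ := h
          exact ⟨rfl, rfl⟩
      | cons y v ih =>
        intro k r h
        obtain ⟨k', r', hk'⟩ := List.exists_cons_of_ne_nil (code_ne_nil v)
        rw [code, hk'] at h
        simp only [addHead_cons, List.cons.injEq] at h
        obtain ⟨rfl, rfl⟩ := h
        simpa [spell, endDir, pos_inv] using ih k' r' hk'
    obtain ⟨hs1, hs2⟩ := hs v k r hk
    rw [← pos_inv, add_comm k, add_neg_cancel_left, hs1, hs2, add_comm d,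
      add_neg_cancel_left] at h2
    refine ⟨spell d l, ?_, ?_⟩
    · rw [h2.1, hv, ltr_pos, ← wordValue_cons]
    · rw [hd, code_spell h2.2]

/-! ### The word length as the length of the normal form. -/

theorem Cross.length {s t : List (Fin 8)} (h : Cross s t) :
    t.length = s.length + 1 ∨ s.length = t.length + 1 := by
  cases h with
  | cancel => simp
  | extend => simp
  | push h => simp [h.length]
  | pull h => simp [h.length]

/-- The word length of an element. -/
noncomputable def norm (g : SurfaceGroup) : ℕ := (act g base).1.length - 1

theorem length_act (g : SurfaceGroup) : (act g base).1.length = norm g + 1 := by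
  have := List.length_pos_iff.2 (act g base).2.1
  rw [norm]; omega

theorem norm_letter_mul (x : Letter) (g : SurfaceGroup) :
    norm (wordValue [x] * g) = norm g + 1 ∨ norm g = norm (wordValue [x] * g) + 1 := by
  have := (cross_prepend x (act g base)).length
  rw [length_addHead, length_addHead, ← act_letter, ← Equiv.Perm.mul_apply, ← map_mul,
    length_act, length_act] at this
  omega

theorem norm_word_mul_le (w : List Letter) (g : SurfaceGroup) :
    norm (wordValue w * g) ≤ w.length + norm g := by
  induction w with
  | nil => simp
  | cons x w ih =>
    rw [wordValue_cons, mul_assoc]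
    have := norm_letter_mul x (wordValue w * g)
    simp only [List.length_cons]
    omega

theorem le_norm_word_mul (w : List Letter) (g : SurfaceGroup) :
    norm g ≤ w.length + norm (wordValue w * g) := by
  induction w with
  | nil => simp
  | cons x w ih =>
    rw [wordValue_cons, mul_assoc]
    have := norm_letter_mul x (wordValue w * g)
    simp only [List.length_cons]
    omega

theorem norm_one : norm 1 = 0 := by simp [norm, base]

theorem norm_wordValue_le (w : List Letter) : norm (wordValue w) ≤ w.length := by
  simpa [norm_one] using norm_word_mul_le w 1

theorem exists_word (g : SurfaceGroup) : ∃ w, wordValue w = g ∧ w.length = norm g := by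
  obtain ⟨w, hw, hc⟩ := exists_code g
  refine ⟨w, hw, ?_⟩
  rw [norm, hc]; simp

theorem norm_mul_le (g h : SurfaceGroup) : norm (g * h) ≤ norm g + norm h := by
  obtain ⟨w, rfl, hw⟩ := exists_word g
  rw [← hw]
  exact norm_word_mul_le w h

theorem norm_of_good {w : List Letter} (h : Good (code w).tail) :
    norm (wordValue w) = w.length := by
  rw [norm, act_eq_code h]; simp

/-! ### Windows of bi-infinite sequences -/

/-- The `l` consecutive values of `f` from the index `i` on. -/
def window {α : Type*} (f : ℤ → α) : ℤ → ℕ → List α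
  | _, 0 => []
  | i, l + 1 => f i :: window f (i + 1) l

section Window

variable {α : Type*} (f : ℤ → α)

@[simp] theorem length_window (i : ℤ) (l : ℕ) : (window f i l).length = l := by
  induction l generalizing i with
  | zero => rfl
  | succ l ih => simp [window, ih]

theorem window_append (i : ℤ) (a b : ℕ) :
    window f i (a + b) = window f i a ++ window f (i + a) b := by
  induction a generalizing i with
  | zero => simp [window]
  | succ a ih =>
    rw [Nat.succ_add, window, window, ih, List.cons_append]
    push_cast
    rw [add_assoc, add_comm (1 : ℤ)]

theorem getElem?_window (i : ℤ) (l k : ℕ) (h : k < l) : (window f i l)[k]? = some (f (i + k)) := by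
  induction l generalizing i k with
  | zero => omega
  | succ l ih =>
    cases k with
    | zero => simp [window]
    | succ k =>
      rw [window, List.getElem?_cons_succ, ih _ _ (by omega)]
      congr 2
      push_cast; ring

theorem window_eq_iff {g : ℤ → α} {i j : ℤ} {l : ℕ} :
    window f i l = window g j l ↔ ∀ k : ℕ, k < l → f (i + k) = g (j + k) := by
  constructor
  · intro h k hk
    have := getElem?_window f i l k hk
    rw [h, getElem?_window g j l k hk] at this
    simpa using this.symm
  · intro h
    apply List.ext_getElem?
    intro k
    by_cases hk : k < l
    · rw [getElem?_window _ _ _ _ hk, getElem?_window _ _ _ _ hk, h k hk]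
    · rw [List.getElem?_eq_none (by simpa using hk), List.getElem?_eq_none (by simpa using hk)]

theorem window_eq_ofFn (i : ℤ) (l : ℕ) :
    window f i l = List.ofFn fun k : Fin l => f (i + (k : ℕ)) := by
  apply List.ext_getElem?
  intro k
  by_cases hk : k < l
  · rw [getElem?_window _ _ _ _ hk, List.getElem?_ofFn, dif_pos hk]
  · rw [List.getElem?_eq_none (by simpa using hk), List.getElem?_eq_none (by simpa using hk)]

end Window

theorem periodic_mul {α : Type*} {f : ℤ → α} {n : ℕ} (hper : ∀ i, f (i + n) = f i) (k i : ℤ) :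
    f (i + n * k) = f i := by
  induction k using Int.induction_on generalizing i with
  | zero => simp
  | succ k ih => rw [mul_add, mul_one, ← add_assoc, hper, ih]
  | pred k ih => rw [← hper, ← ih i]; congr 1; ring

/-! ### Lines -/

/-- The turn of a path of letters between the indices `i` and `i + 1`. -/
def tn (x : ℤ → Letter) (i : ℤ) : Fin 8 := pos (x (i + 1)) - pos (inv (x i))

/-- The turns from the index `i` on begin with `677...6777`, the tail of a shortenable chain. -/
inductive Closes (t : ℤ → Fin 8) : ℤ → Prop
  | last {i : ℤ} : t i = 7 → Closes t i
  | step {i : ℤ} : t i = 6 → t (i + 1) = 7 → t (i + 2) = 7 → Closes t (i + 3) → Closes t i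

/-- The turns of a line that is a leftmost geodesic. -/
structure Leftmost (t : ℤ → Fin 8) : Prop where
  zero : ∀ i, t i ≠ 0
  one : ∀ i, t i = 1 → t (i + 1) = 1 → t (i + 2) ≠ 1
  seven : ∀ i, t i = 7 → t (i + 1) = 7 → t (i + 2) = 7 → ¬ Closes t (i + 3)

/-- The periodic sequence `p q q p q q ...`, up to a shift. -/
def Pure (p q : Fin 8) (t : ℤ → Fin 8) : Prop :=
  ∃ c : ℤ, ∀ i : ℤ, t (c + i) = if (3 : ℤ) ∣ i then p else q

/-- The sequence `p q q p q q ...`. -/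
def pat (p q : Fin 8) (i : ℕ) : Fin 8 := if i % 3 = 0 then p else q

theorem pat_add_three (p q : Fin 8) (i : ℕ) : pat p q (i + 3) = pat p q i := by
  simp [pat]

theorem Flip.closes {t : ℤ → Fin 8} {l l' : List (Fin 8)} (h : Flip l l') (i : ℤ) (n : ℕ)
    (e : Fin 8) (he : l' = window t i n ++ [e]) : Closes t i := by
  induction h generalizing i n with
  | last q r =>
    cases n with
    | zero => simp [window] at he
    | succ n =>
      simp only [window, List.cons_append, List.cons.injEq] at he
      exact .last he.1.symm
  | step h ih =>
    match n with
    | 0 => simp [window] at he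
    | 1 => simp [window] at he
    | 2 =>
      simp only [window, List.cons_append, List.cons.injEq, List.nil_append] at he
      exact (h.ne_nil' he.2.2.2).elim
    | n + 3 =>
      simp only [window, List.cons_append, List.cons.injEq] at he
      obtain ⟨h1, h2, h3, h4⟩ := he
      refine .step h1.symm h2.symm ?_ ?_
      · rw [h3]; congr 1; ring
      · have := ih _ _ h4
        convert this using 1; ring

/-- The entry `e` is arbitrary because the last entry of a list, the turn into the spike, never
belongs to a pattern. -/
theorem Leftmost.good {t : ℤ → Fin 8} (h : Leftmost t) (i : ℤ) (n : ℕ) (e : Fin 8) :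
    Good (window t i n ++ [e]) := by
  induction n generalizing i with
  | zero => exact good_singleton e
  | succ n ih =>
    change ¬ BadHead (t i :: (window t (i + 1) n ++ [e])) ∧ _
    refine ⟨fun hb => ?_, ih (i + 1)⟩
    generalize hk : t i = k at hb
    generalize hl : window t (i + 1) n ++ [e] = l at hb
    cases hb with
    | zero => exact h.zero i hk
    | one q r =>
      match n with
      | 0 => simp [window] at hl
      | 1 => simp [window] at hl
      | n + 2 =>
        simp only [window, List.cons_append, List.cons.injEq] at hl
        refine h.one i hk hl.1 ?_
        rw [← hl.2.1]; congr 1; ring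
    | seven hf =>
      match n with
      | 0 => simp [window] at hl
      | 1 =>
        simp only [window, List.cons_append, List.cons.injEq, List.nil_append] at hl
        exact hf.ne_nil' hl.2.2.symm
      | n + 2 =>
        simp only [window, List.cons_append, List.cons.injEq] at hl
        refine h.seven i hk hl.1 ?_ ?_
        · rw [← hl.2.1]; congr 1; ring
        · have := hf.closes _ _ _ hl.2.2.symm
          convert this using 1; ring

/-- The turns of a path starting with a stretch of a line. -/
theorem tail_code_window (x : ℤ → Letter) (i : ℤ) (l m : ℕ) :
    (code (window x i l ++ window x (i + l) (m + 1))).tail =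
      window (tn x) i l ++ (code (window x (i + l) (m + 1))).tail := by
  induction l generalizing i with
  | zero => simp [window]
  | succ l ih =>
    have ih := ih (i + 1)
    rw [show i + 1 + (l : ℤ) = i + ((l + 1 : ℕ) : ℤ) by push_cast; ring] at ih
    have hc : code (window x (i + 1) l ++ window x (i + ((l + 1 : ℕ) : ℤ)) (m + 1)) =
        pos (x (i + 1)) ::
          (code (window x (i + 1) l ++ window x (i + ((l + 1 : ℕ) : ℤ)) (m + 1))).tail := by
      cases l with
      | zero => simp [window, code]
      | succ l => simp [window, code]
    rw [window, List.cons_append, code, List.tail_cons, hc, ih, addHead_cons,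
      window.eq_2 (tn x), List.cons_append, tn, sub_eq_add_neg]

theorem Leftmost.good_code {x : ℤ → Letter} (h : Leftmost (tn x)) (i : ℤ) (l : ℕ) :
    Good (code (window x i l)).tail := by
  cases l with
  | zero => trivial
  | succ l =>
    have := tail_code_window x i l 0
    rw [← window_append] at this
    rw [this]
    exact h.good _ _ _

theorem Leftmost.norm_window {x : ℤ → Letter} (h : Leftmost (tn x)) (i : ℤ) (l : ℕ) :
    norm (wordValue (window x i l)) = l := by
  rw [norm_of_good (h.good_code i l), length_window]

/-- Three extra indices let the run be aligned with a multiple of 3 and still cover a whole period;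
then `3 ∣ n`, since otherwise `p = q`, and the pattern extends by periodicity. -/
theorem pure_of_run {t : ℤ → Fin 8} {n : ℕ} (hn : 0 < n) (hper : ∀ i, t (i + n) = t i)
    {p q : Fin 8} (hpq : p ≠ q) (j : ℤ) (o : ℕ)
    (h : ∀ i : ℕ, i < n + 3 → t (j + i) = pat p q (i + o)) : Pure p q t := by
  obtain ⟨d, hd3, hd⟩ : ∃ d : ℕ, d < 3 ∧ (d + o) % 3 = 0 := ⟨(3 - o % 3) % 3, by omega, by omega⟩
  have h' : ∀ i : ℕ, i ≤ n → t (j + d + i) = if i % 3 = 0 then p else q := by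
    intro i hi
    have := h (d + i) (by omega)
    rw [pat] at this
    push_cast at this
    rw [add_assoc, this]
    congr 1
    simp only [eq_iff_iff]
    omega
  have hn3 : n % 3 = 0 := by
    by_contra hc
    have h1 := h' n le_rfl
    rw [if_neg hc, hper] at h1
    have h2 := h' 0 (by omega)
    simp only [Nat.cast_zero, add_zero, Nat.zero_mod, if_true] at h2
    exact hpq (h2.symm.trans h1)
  refine ⟨j + d, fun i => ?_⟩
  have hnz : (0 : ℤ) < n := by exact_mod_cast hn
  have h0 := Int.emod_nonneg i hnz.ne'
  have h1 := Int.emod_lt_of_pos i hnz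
  have h2 := Int.emod_add_mul_ediv i n
  rw [← h2, ← add_assoc, periodic_mul hper]
  obtain ⟨r, hr⟩ := Int.eq_ofNat_of_zero_le h0
  rw [hr] at h1 ⊢
  rw [h' r (by omega)]
  congr 1
  have : (3 : ℤ) ∣ n * (i / n) := Dvd.dvd.mul_right (by omega) _
  simp only [eq_iff_iff]
  rw [Int.dvd_add_left this]
  omega

theorem tn_periodic {x : ℤ → Letter} {n : ℕ} (hper : ∀ i, x (i + n) = x i) (i : ℤ) :
    tn x (i + n) = tn x i := by
  rw [tn, tn, hper, show i + n + 1 = i + 1 + n by ring, hper]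

/-! ### Prepending a line to an element -/

/-- The natural number `f t + C - t` never increases, so it is constant from the place of its
minimum on. -/
theorem eventually_succ {f : ℕ → ℕ} (hf : ∀ t, f (t + 1) = f t + 1 ∨ f t = f (t + 1) + 1) (C : ℕ)
    (hC : ∀ t, t ≤ f t + C) : ∃ t₀, ∀ t ≥ t₀, f (t + 1) = f t + 1 := by
  have hwf : (Set.range fun t => f t + C - t).Nonempty := ⟨_, 0, rfl⟩
  obtain ⟨t₀, ht₀⟩ := WellFounded.min_mem (wellFounded_lt (α := ℕ)) _ hwf
  have hmin : ∀ t, f t₀ + C - t₀ ≤ f t + C - t := fun t => by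
    have := WellFounded.not_lt_min (wellFounded_lt (α := ℕ)) (Set.range fun t => f t + C - t)
      (x := f t + C - t) ⟨t, rfl⟩
    rw [← ht₀] at this
    exact not_lt.1 this
  have key : ∀ t ≥ t₀, f t + C - t = f t₀ + C - t₀ := by
    intro t ht
    induction t, ht using Nat.le_induction with
    | base => rfl
    | succ t ht ih =>
      have := hmin (t + 1)
      have := hC t
      have := hC (t + 1)
      rcases hf t with h | h <;> omega
  refine ⟨t₀, fun t ht => ?_⟩
  have h1 := key t ht
  have h2 := key (t + 1) (by omega)
  have := hC t
  have := hC (t + 1)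
  rcases hf t with h | h <;> omega

theorem addHead_eq_iff {c : Fin 8} {s r : List (Fin 8)} :
    addHead (-c) s = r ↔ s = addHead c r := by
  constructor
  · rintro rfl
    rw [addHead_addHead, neg_add_cancel, addHead_zero]
  · rintro rfl
    rw [addHead_addHead, add_neg_cancel, addHead_zero]

theorem Cross.of_length {s t : List (Fin 8)} (h : Cross s t) (hl : t.length = s.length + 1) :
    t = 0 :: s ∨ ∃ l l', Flip l l' ∧ s = 1 :: 1 :: 1 :: l ∧ t = 7 :: 7 :: 7 :: l' := by
  cases h with
  | cancel => simp at hl; omega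
  | extend => exact .inl rfl
  | push h => exact .inr ⟨_, _, h, rfl, rfl⟩
  | pull h => simp [h.length] at hl

/-- Prepending the letters `p 0, p 1, ...` one after the other, with increasing lengths. -/
theorem eventually_literal {σ : ℕ → List (Fin 8)} {p : ℕ → Letter} {τ : ℕ → Fin 8}
    (hτ : ∀ t, τ t = pos (p t) - pos (inv (p (t + 1)))) (h1 : ∀ t, τ t = 1 → τ (t + 1) = 1 →
      τ (t + 2) ≠ 1) (hpure : ∀ t, ∃ k, ¬ (τ (t + 3 * k) = 2 ∧ τ (t + 3 * k + 1) = 1 ∧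
      τ (t + 3 * k + 2) = 1)) (t₀ : ℕ)
    (hσ : ∀ t ≥ t₀, addHead (-(pos (p t))) (σ (t + 1)) = 0 :: addHead (-(pos (inv (p t)))) (σ t) ∨
      ∃ l l', Flip l l' ∧ addHead (-(pos (inv (p t)))) (σ t) = 1 :: 1 :: 1 :: l ∧
        addHead (-(pos (p t))) (σ (t + 1)) = 7 :: 7 :: 7 :: l') :
    ∃ t₁, ∀ t ≥ t₁, σ (t + 1) = pos (p t) :: addHead (-(pos (inv (p t)))) (σ t) := by
  let Lit (t : ℕ) := σ (t + 1) = pos (p t) :: addHead (-(pos (inv (p t)))) (σ t)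
  replace hσ : ∀ t ≥ t₀, Lit t ∨ ∃ l l', addHead (-(pos (inv (p t)))) (σ t) = 1 :: 1 :: 1 :: l ∧
      σ (t + 1) = (pos (p t) + 7) :: 7 :: 7 :: l' := by
    intro t ht
    refine (hσ t ht).imp (fun h => ?_) ?_
    · rw [addHead_eq_iff] at h
      simpa [Lit] using h
    · rintro ⟨l, l', -, h1, h2⟩
      rw [addHead_eq_iff, addHead_cons, add_comm (7 : Fin 8)] at h2
      exact ⟨l, l', h1, h2⟩
  have next : ∀ t c r, σ (t + 1) = (pos (p t) + c) :: r →
      addHead (-(pos (inv (p (t + 1))))) (σ (t + 1)) = (τ t + c) :: r := by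
    intro t c r h
    rw [h, addHead_cons, hτ]
    congr 1; abel
  have next0 : ∀ t r, σ (t + 1) = pos (p t) :: r →
      addHead (-(pos (inv (p (t + 1))))) (σ (t + 1)) = τ t :: r := by
    intro t r h
    have := next t 0 r (by rw [h, add_zero])
    rwa [add_zero] at this
  -- After three literal steps the front of the list consists of turns of the line itself, and these
  -- do not contain the `1 1 1` needed for a push.
  have three : ∀ t, t₀ ≤ t → Lit t → Lit (t + 1) → Lit (t + 2) → ∀ k, Lit (t + k) := by
    intro t ht a b c k
    suffices Lit (t + k) ∧ Lit (t + k + 1) ∧ Lit (t + k + 2) from this.1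
    induction k with
    | zero => exact ⟨a, b, c⟩
    | succ k ih =>
      obtain ⟨a, b, c⟩ := ih
      refine ⟨b, c, ?_⟩
      rcases hσ (t + k + 3) (by omega) with h | ⟨l, l', h, -⟩
      · exact h
      have c' := next0 _ _ c
      rw [next0 _ _ b, next0 _ _ a] at c'
      rw [c'] at h
      simp only [List.cons.injEq] at h
      exact absurd h.1 (h1 _ h.2.2.1 h.2.1)
  by_contra hcon
  push Not at hcon
  have noLit : ∀ t, t₀ ≤ t → Lit t → Lit (t + 1) → Lit (t + 2) → False := by
    intro t ht a b c
    obtain ⟨s, hs, hs'⟩ := hcon t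
    obtain ⟨k, rfl⟩ := Nat.exists_eq_add_of_le hs
    exact hs' (three t ht a b c k)
  -- A push leaves `7 7` behind the head, so the next two steps are literal; the step after them is
  -- not, by `noLit`, and the `1 1 1` it needs fixes the turns in between as `2, 1, 1`.
  have push : ∀ t, t₀ ≤ t → ¬ Lit t →
      ¬ Lit (t + 3) ∧ τ t = 2 ∧ τ (t + 1) = 1 ∧ τ (t + 2) = 1 := by
    intro t ht hlit
    rcases hσ t ht with h | ⟨l, l', -, h⟩
    · exact absurd h hlit
    have e1 := next _ _ _ h
    have L1 : Lit (t + 1) := by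
      rcases hσ (t + 1) (by omega) with h | ⟨m, m', h, -⟩
      · exact h
      rw [e1] at h
      simp at h
    have e2 := next0 _ _ L1
    rw [e1] at e2
    have L2 : Lit (t + 2) := by
      rcases hσ (t + 2) (by omega) with h | ⟨m, m', h, -⟩
      · exact h
      rw [e2] at h
      simp at h
    have e3 := next0 _ _ L2
    rw [e2] at e3
    have L3 : ¬ Lit (t + 3) := fun h => noLit (t + 1) (by omega) L1 L2 h
    rcases hσ (t + 3) (by omega) with h | ⟨m, m', h, -⟩
    · exact absurd h L3
    rw [e3] at h
    simp only [List.cons.injEq] at h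
    refine ⟨L3, ?_, h.2.1, h.1⟩
    rw [eq_sub_of_add_eq h.2.2.1]; decide
  obtain ⟨s, hs, hs'⟩ := hcon t₀
  have all : ∀ k, ¬ Lit (s + 3 * k) := by
    intro k
    induction k with
    | zero => exact hs'
    | succ k ih => exact (push _ (by omega) ih).1
  obtain ⟨k, hk⟩ := hpure s
  exact hk (push _ (by omega) (all k)).2

theorem window_shift {α : Type*} {f : ℤ → α} {n : ℕ} (hper : ∀ i, f (i + n) = f i) (k i : ℤ)
    (l : ℕ) : window f (i + n * k) l = window f i l := by
  rw [window_eq_iff]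
  intro j _
  rw [add_right_comm, periodic_mul hper]

theorem wordValue_window_mul {x : ℤ → Letter} {n : ℕ} (hper : ∀ i, x (i + n) = x i) (k : ℕ) :
    wordValue (window x 0 (n * k)) = wordValue (window x 0 n) ^ k := by
  induction k with
  | zero => simp [window]
  | succ k ih =>
    rw [mul_add, mul_one, window_append, wordValue_append, ih, pow_succ]
    congr 2
    rw [← window_shift hper k 0 n]
    push_cast
    rfl

/-- After sufficiently many letters of a line have been prepended to an element, the further ones
do not interact with it. -/
theorem Leftmost.exists_literal {x : ℤ → Letter} {n : ℕ} (hx : Leftmost (tn x)) (hn : 0 < n)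
    (hper : ∀ i, x (i + n) = x i) (hp : ¬ Pure 2 1 (tn x)) (g : SurfaceGroup) :
    ∃ (K : ℕ) (R : List Letter), wordValue R = wordValue (window x 0 n) ^ K * g ∧
      ∀ s : ℕ, (act (wordValue (window x (-s) s) * wordValue R) base).1 =
        code (window x (-s) s ++ R) := by
  let p (t : ℕ) : Letter := x (-t - 1)
  let h (t : ℕ) : SurfaceGroup := wordValue (window x (-t) t) * g
  have hstep : ∀ t : ℕ, window x (-(t + 1 : ℕ)) (t + 1) = p t :: window x (-t) t := by
    intro t
    rw [window]
    congr 2 <;> push_cast <;> ring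
  have hh : ∀ t, h (t + 1) = wordValue [p t] * h t := by
    intro t
    simp only [h]
    rw [hstep, wordValue_cons, mul_assoc]
  have hact : ∀ t, act (h (t + 1)) base = prepend (p t) (act (h t) base) := by
    intro t
    rw [hh, map_mul, act_letter, Equiv.Perm.mul_apply]
  -- The lengths change by one at each step and fall behind the number of letters by at most the
  -- length of `g⁻¹`.
  obtain ⟨t₀, ht₀⟩ := eventually_succ (f := fun t => norm (h t)) (fun t => by
    simpa only [hh] using norm_letter_mul (p t) (h t)) (norm g⁻¹) (fun t => by
    have := norm_mul_le (h t) g⁻¹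
    rwa [mul_inv_cancel_right, hx.norm_window] at this)
  have htn : ∀ t : ℕ, tn x (-t - 2) = pos (p t) - pos (inv (p (t + 1))) := by
    intro t
    simp only [tn, p]
    rw [show -(t : ℤ) - 2 + 1 = -t - 1 by ring, show -((t + 1 : ℕ) : ℤ) - 1 = -t - 2 by
      push_cast; ring]
  obtain ⟨t₁, ht₁⟩ := eventually_literal (σ := fun t => (act (h t) base).1) (p := p)
    (τ := fun t => tn x (-t - 2)) htn (fun t h1 h2 h3 => by
      refine hx.one (-(t + 2 : ℕ) - 2) h3 ?_ ?_
      · exact (congrArg (tn x) (by push_cast; ring)).trans h2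
      · exact (congrArg (tn x) (by push_cast; ring)).trans h1) (fun t => by
      by_contra hcon
      push Not at hcon
      refine hp (pure_of_run hn (tn_periodic hper) (by decide) (-(t + 3 * (n + 1) : ℕ) - 2) 0 ?_)
      intro i hi
      obtain ⟨a, b, rfl, hb⟩ : ∃ a b, i = 3 * a + b ∧ b < 3 := ⟨i / 3, i % 3, by omega, by omega⟩
      have h0 := hcon (n + 1 - a)
      have h1 := hcon (n + 1 - (a + 1))
      interval_cases b
      · rw [pat, if_pos (by omega), ← h0.1]
        congr 1; omega
      · rw [pat, if_neg (by omega), ← h1.2.2]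
        congr 1; omega
      · rw [pat, if_neg (by omega), ← h1.2.1]
        congr 1; omega) t₀ (fun t ht => by
      have hc := cross_prepend (p t) (act (h t) base)
      rw [← hact] at hc
      refine hc.of_length ?_
      rw [length_addHead, length_addHead, length_act, length_act, ht₀ t ht])
  -- A whole number of periods, so that further prepending starts again at the index `0` of the
  -- line.
  obtain ⟨R, hR, hRc⟩ := exists_code (h (n * t₁))
  have hle : t₁ ≤ n * t₁ := Nat.le_mul_of_pos_left _ hn
  have hval : ∀ s : ℕ, wordValue (window x (-s) s) * wordValue R = h (n * t₁ + s) := by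
    intro s
    rw [hR]
    simp only [h]
    rw [add_comm (n * t₁), window_append, wordValue_append, mul_assoc]
    congr 2
    · rw [← window_shift hper (-t₁)]
      congr 2; push_cast; ring
    · congr 3; push_cast; ring
  refine ⟨t₁, R, ?_, ?_⟩
  · rw [hR]
    simp only [h]
    rw [← wordValue_window_mul hper, ← window_shift hper (-t₁) 0]
    congr 3
    push_cast; ring
  · intro s
    rw [hval]
    induction s with
    | zero => simpa [window] using hRc
    | succ s ih =>
      have hps : p (n * t₁ + s) = p s := by
        simp only [p]
        rw [← periodic_mul hper t₁ (-((n * t₁ + s : ℕ) : ℤ) - 1)]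
        congr 1; push_cast; ring
      rw [← add_assoc, ht₁ _ (by omega), ih, hstep, hps]
      rfl

/-! ### Prepending a word to a line -/

/-- A push either ends inside `A` and leaves `b` untouched, or all of `A` follows the chain
`211211...`. -/
theorem Flip.exists_suffix {l l' b : List (Fin 8)} (h : Flip l l') (A : List (Fin 8))
    (hl : l = A ++ b) : (∃ a, l' = a ++ b) ∨ ∀ i v, A[i]? = some v → v = pat 2 1 i := by
  induction h generalizing A with
  | last q r =>
    cases A with
    | nil => simp
    | cons k A =>
      simp only [List.cons_append, List.cons.injEq] at hl
      exact .inl ⟨7 :: (q - 1) :: A, by simp [hl.2]⟩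
  | @step l l' h ih =>
    match A with
    | [] => simp
    | [u] =>
      simp only [List.cons_append, List.cons.injEq] at hl
      right
      intro i v hv
      match i with
      | 0 => simp only [List.getElem?_cons_zero, Option.some.injEq] at hv; rw [← hv, ← hl.1]; rfl
      | i + 1 => simp at hv
    | [u, w] =>
      simp only [List.cons_append, List.cons.injEq] at hl
      right
      intro i v hv
      match i with
      | 0 => simp only [List.getElem?_cons_zero, Option.some.injEq] at hv; rw [← hv, ← hl.1]; rfl
      | 1 =>
        simp only [List.getElem?_cons_succ, List.getElem?_cons_zero, Option.some.injEq] at hv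
        rw [← hv, ← hl.2.1]; rfl
      | i + 2 => simp at hv
    | u :: w :: z :: A =>
      simp only [List.cons_append, List.cons.injEq] at hl
      obtain ⟨h1, h2, h3, h4⟩ := hl
      rcases ih A h4 with ⟨a, ha⟩ | hA
      · exact .inl ⟨6 :: 7 :: 7 :: a, by simp [ha]⟩
      right
      intro i v hv
      match i with
      | 0 => simp only [List.getElem?_cons_zero, Option.some.injEq] at hv; rw [← hv, ← h1]; rfl
      | 1 =>
        simp only [List.getElem?_cons_succ, List.getElem?_cons_zero, Option.some.injEq] at hv
        rw [← hv, ← h2]; rfl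
      | 2 =>
        simp only [List.getElem?_cons_succ, List.getElem?_cons_zero, Option.some.injEq] at hv
        rw [← hv, ← h3]; rfl
      | i + 3 =>
        simp only [List.getElem?_cons_succ] at hv
        rw [hA i v hv, pat_add_three]

/-- The same for a pull. The last entry of `A` is exempt: it may be the closing `7`, in which case
the entry after it, already in `b`, is changed too. -/
theorem Flip.exists_suffix' {l l' b : List (Fin 8)} (h : Flip l l') (A : List (Fin 8))
    (hl : l' = A ++ b) :
    (∃ a, l = a ++ b) ∨ ∀ i v, i + 1 < A.length → A[i]? = some v → v = pat 6 7 i := by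
  induction h generalizing A with
  | last q r =>
    match A with
    | [] => simp
    | [k] => simp
    | k :: m :: A =>
      simp only [List.cons_append, List.cons.injEq] at hl
      exact .inl ⟨q :: A, by simp [hl.2.2]⟩
  | @step l l' h ih =>
    match A with
    | [] => simp
    | [u] => simp
    | [u, w] =>
      simp only [List.cons_append, List.cons.injEq] at hl
      right
      intro i v hi hv
      simp only [List.length_cons, List.length_nil] at hi
      obtain rfl : i = 0 := by omega
      simp only [List.getElem?_cons_zero, Option.some.injEq] at hv
      rw [← hv, ← hl.1]; rfl
    | u :: w :: z :: A =>
      simp only [List.cons_append, List.cons.injEq] at hl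
      obtain ⟨h1, h2, h3, h4⟩ := hl
      rcases ih A h4 with ⟨a, ha⟩ | hA
      · exact .inl ⟨2 :: 1 :: 1 :: a, by simp [ha]⟩
      right
      intro i v hi hv
      match i with
      | 0 => simp only [List.getElem?_cons_zero, Option.some.injEq] at hv; rw [← hv, ← h1]; rfl
      | 1 =>
        simp only [List.getElem?_cons_succ, List.getElem?_cons_zero, Option.some.injEq] at hv
        rw [← hv, ← h2]; rfl
      | 2 =>
        simp only [List.getElem?_cons_succ, List.getElem?_cons_zero, Option.some.injEq] at hv
        rw [← hv, ← h3]; rfl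
      | i + 3 =>
        simp only [List.getElem?_cons_succ] at hv
        simp only [List.length_cons] at hi
        rw [hA i v (by omega) hv, pat_add_three]

/-- Crossing an edge affects only the beginning of a path that is not pure. -/
theorem Cross.exists_suffix {t : ℤ → Fin 8} {n : ℕ} (hn : 0 < n) (hper : ∀ i, t (i + n) = t i)
    (hp : ¬ Pure 2 1 t) (hp' : ¬ Pure 6 7 t) {P b s : List (Fin 8)} (hP : 4 ≤ P.length) (j : ℤ)
    (h : Cross (P ++ window t j (n + 4) ++ b) s) : ∃ a, a ≠ [] ∧ s = a ++ b := by
  obtain ⟨k₀, k₁, k₂, k₃, P, rfl⟩ : ∃ k₀ k₁ k₂ k₃ P', P = k₀ :: k₁ :: k₂ :: k₃ :: P' := by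
    match P, hP with
    | k₀ :: k₁ :: k₂ :: k₃ :: P, _ => exact ⟨_, _, _, _, _, rfl⟩
  have run : ∀ (p q : Fin 8), p ≠ q → (∀ i v, i + 1 < (k₃ :: P ++ window t j (n + 4)).length →
      (k₃ :: P ++ window t j (n + 4))[i]? = some v → v = pat p q i) → Pure p q t := by
    intro p q hpq hrun
    refine pure_of_run hn hper hpq j (P.length + 1) fun i hi => ?_
    refine hrun _ _ ?_ ?_
    · simp only [List.length_append, List.length_cons, length_window]
      omega
    · rw [List.getElem?_append_right (by simp)]
      simp only [List.length_cons, Nat.add_sub_cancel]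
      exact getElem?_window _ _ _ _ (by omega)
  generalize hs : k₀ :: k₁ :: k₂ :: k₃ :: P ++ window t j (n + 4) ++ b = u at h
  cases h with
  | cancel h1 h2 =>
    simp only [List.cons_append, List.cons.injEq] at hs
    exact ⟨k₁ :: k₂ :: k₃ :: P ++ window t j (n + 4), by simp, by simp [← hs.2]⟩
  | extend h1 h2 =>
    exact ⟨0 :: k₀ :: k₁ :: k₂ :: k₃ :: P ++ window t j (n + 4), by simp, by simp [← hs]⟩
  | @push l l' hf =>
    simp only [List.cons_append, List.cons.injEq] at hs
    rcases hf.exists_suffix (b := b) (k₃ :: P ++ window t j (n + 4)) (by simp [← hs.2.2.2])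
      with ⟨a, rfl⟩ | hA
    · exact ⟨7 :: 7 :: 7 :: a, by simp, by simp⟩
    · exact absurd (run 2 1 (by decide) fun i v _ => hA i v) hp
  | @pull l l' hf =>
    simp only [List.cons_append, List.cons.injEq] at hs
    rcases hf.exists_suffix' (b := b) (k₃ :: P ++ window t j (n + 4)) (by simp [← hs.2.2.2])
      with ⟨a, rfl⟩ | hA
    · exact ⟨1 :: 1 :: 1 :: a, by simp, by simp⟩
    · exact absurd (run 6 7 (by decide) hA) hp'

theorem addHead_append {c : Fin 8} {a b : List (Fin 8)} (ha : a ≠ []) :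
    addHead c (a ++ b) = addHead c a ++ b := by
  cases a with
  | nil => exact absurd rfl ha
  | cons => rfl

theorem code_append_tail (v w : List Letter) : ∃ a, code (v ++ w) = a ++ (code w).tail := by
  induction v with
  | nil =>
    obtain ⟨k, r, hk⟩ := List.exists_cons_of_ne_nil (code_ne_nil w)
    exact ⟨[k], by simp [hk]⟩
  | cons x v ih =>
    obtain ⟨a, ha⟩ := ih
    cases a with
    | nil =>
      have := congrArg List.length ha
      simp at this
      omega
    | cons k a =>
      exact ⟨pos x :: (k + -(pos (inv x))) :: a, by simp [code, ha]⟩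

/-- Prepending a fixed word affects only a bounded initial stretch of a line. -/
theorem Leftmost.exists_suffix {y : ℤ → Letter} {n : ℕ} (hy : Leftmost (tn y)) (hn : 0 < n)
    (hper : ∀ i, y (i + n) = y i) (hp : ¬ Pure 2 1 (tn y)) (hp' : ¬ Pure 6 7 (tn y))
    (w : List Letter) : ∃ C : ℕ, ∀ c ≥ C, ∀ (i : ℤ) (m : ℕ), ∃ a,
      (act (wordValue w * wordValue (window y i (c + m))) base).1 =
        a ++ (code (window y (i + c) m)).tail := by
  induction w with
  | nil =>
    refine ⟨0, fun c _ i m => ?_⟩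
    rw [wordValue_nil, one_mul, act_eq_code (hy.good_code _ _), window_append]
    exact code_append_tail _ _
  | cons x w ih =>
    obtain ⟨C, hC⟩ := ih
    -- One more letter spoils at most `n + 8` further turns: four as the head of the crossing, then
    -- `n + 4` in which a chain must end.
    refine ⟨C + (n + 8), fun c hc i m => ?_⟩
    obtain ⟨c, rfl⟩ := Nat.exists_eq_add_of_le' (Nat.le_of_add_left_le hc)
    cases m with
    | zero => exact ⟨_, by simp [window, code]; rfl⟩
    | succ m =>
    have hw : (code (window y (i + c) ((4 + (n + 4)) + (m + 1)))).tail =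
        window (tn y) (i + c) 4 ++ window (tn y) (i + c + 4) (n + 4) ++
          (code (window y (i + (c + (n + 8) : ℕ)) (m + 1))).tail := by
      rw [window_append y, tail_code_window, window_append (tn y)]
      congr 4
      push_cast; ring
    obtain ⟨a, ha⟩ := hC c (by omega) i ((4 + (n + 4)) + (m + 1))
    rw [hw, show c + ((4 + (n + 4)) + (m + 1)) = c + (n + 8) + (m + 1) by ring] at ha
    have hcross := cross_prepend x (act (wordValue w * wordValue
      (window y i (c + (n + 8) + (m + 1)))) base)
    rw [← act_letter, ← Equiv.Perm.mul_apply, ← map_mul, ← mul_assoc, ← wordValue_cons, ha,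
      ← List.append_assoc, ← List.append_assoc, addHead_append (by simp [window]),
      addHead_append (by simp [window])] at hcross
    obtain ⟨a', ha', he⟩ := Cross.exists_suffix hn (tn_periodic hper) hp hp' (by simp) _ hcross
    rw [addHead_eq_iff, addHead_append ha'] at he
    exact ⟨_, he⟩

/-- The spike has a fixed direction, so the last turn determines the last letter, and the earlier
turns determine the earlier letters from back to front. -/
theorem tail_code_injective {v w : List Letter} (h : (code v).tail = (code w).tail) : v = w := by
  induction v generalizing w with
  | nil =>
    cases w with
    | nil => rfl
    | cons y w =>
      have := congrArg List.length h
      simp [code] at this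
  | cons x v ih =>
    cases w with
    | nil =>
      have := congrArg List.length h
      simp [code] at this
    | cons y w =>
      obtain ⟨k, r, hk⟩ := List.exists_cons_of_ne_nil (code_ne_nil v)
      obtain ⟨d, l, hd⟩ := List.exists_cons_of_ne_nil (code_ne_nil w)
      simp only [code, List.tail_cons, hk, hd, addHead_cons, List.cons.injEq] at h
      have hvw : v = w := ih (by rw [hk, hd]; exact h.2)
      subst hvw
      rw [hk, List.cons.injEq] at hd
      rw [← hd.1, add_right_inj, neg_inj] at h
      have := congrArg inv (pos_injective h.1)
      simp only [inv_inv] at this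
      rw [this]

theorem eq_append_of_code_eq {v w : List Letter} {a : List (Fin 8)} (ha : a ≠ [])
    (h : code w = a ++ (code v).tail) : ∃ w', w = w' ++ v := by
  have hlen := congrArg List.length h
  have ha' := List.length_pos_iff.2 ha
  simp only [length_code, List.length_append, List.length_tail, Nat.add_sub_cancel] at hlen
  refine ⟨w.take (w.length - v.length), ?_⟩
  have hdrop : w.drop (w.length - v.length) = v := by
    apply tail_code_injective
    obtain ⟨b, hb⟩ := code_append_tail (w.take (w.length - v.length))
      (w.drop (w.length - v.length))
    rw [List.take_append_drop, h] at hb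
    exact ((List.append_inj' hb (by simp; omega)).2).symm
  conv_lhs => rw [← List.take_append_drop (w.length - v.length) w, hdrop]

/-- Two leftmost lines whose translations are conjugate differ by a shift only. -/
theorem Leftmost.shift_of_conj {x y : ℤ → Letter} {n m : ℕ} (hx : Leftmost (tn x))
    (hy : Leftmost (tn y)) (hn : 0 < n) (hm : 0 < m) (hxn : ∀ i, x (i + n) = x i)
    (hym : ∀ i, y (i + m) = y i) (hpx : ¬ Pure 2 1 (tn x)) (hpy : ¬ Pure 2 1 (tn y))
    (hpy' : ¬ Pure 6 7 (tn y)) {g : SurfaceGroup}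
    (h : wordValue (window x 0 n) * g = g * wordValue (window y 0 m)) :
    n = m ∧ ∃ M L : ℕ, wordValue (window x 0 L) = wordValue (window x 0 n) ^ M * g ∧
      ∀ i, y i = x (i + L) := by
  obtain ⟨K, R, hR, hlit⟩ := hx.exists_literal hn hxn hpx g
  obtain ⟨w, hw⟩ := wordValue_surjective g
  obtain ⟨C, hC⟩ := hy.exists_suffix hm hym hpy hpy' w
  have hpow : ∀ k : ℕ, wordValue (window x 0 n) ^ k * g = g * wordValue (window y 0 m) ^ k :=
    fun k => ((show SemiconjBy g (wordValue (window y 0 m)) (wordValue (window x 0 n)) from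
      h.symm).pow_right k).symm
  have hxk : ∀ k : ℕ, window x (-(n * k : ℕ)) (n * k) = window x 0 (n * k) := by
    intro k
    rw [← window_shift hxn (-k) 0]
    congr 1; push_cast; ring
  have hval : ∀ k : ℕ, wordValue (window x (-(n * k : ℕ)) (n * k)) * wordValue R =
      wordValue w * wordValue (window y 0 (m * (k + K))) := by
    intro k
    rw [hxk, wordValue_window_mul hxn, wordValue_window_mul hym, hR, hw, ← hpow, pow_add, mul_assoc]
  have hlen : ∀ k : ℕ, n * k + R.length =
      norm (wordValue w * wordValue (window y 0 (m * (k + K)))) := by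
    intro k
    have := congrArg List.length (hlit (n * k))
    rw [hval, length_act, length_code, List.length_append, length_window] at this
    omega
  -- The same elements have length `n * k + R.length` and, up to `w.length`, length `m * (k + K)`; a
  -- large `k` forces equality.
  have hnm : n = m := by
    have h1 := norm_word_mul_le w
      (wordValue (window y 0 (m * (w.length + R.length + m * K + 1 + K))))
    have h2 := le_norm_word_mul w
      (wordValue (window y 0 (m * (w.length + R.length + m * K + 1 + K))))
    rw [← hlen, hy.norm_window] at h1 h2
    rcases lt_trichotomy n m with hlt | heq | hlt
    · have := Nat.mul_le_mul_right (w.length + R.length + m * K + 1) (Nat.succ_le_of_lt hlt)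
      rw [Nat.mul_add m _ K] at h1 h2
      rw [Nat.succ_mul] at this
      omega
    · exact heq
    · have := Nat.mul_le_mul_right (w.length + R.length + m * K + 1) (Nat.succ_le_of_lt hlt)
      rw [Nat.mul_add m _ K] at h1 h2
      rw [Nat.succ_mul] at this
      omega
  subst hnm
  refine ⟨rfl, C + 1 + K, n * (C + 1) + R.length, ?_⟩
  -- Both sides come from the normal form of one element: as powers of the translation of `x` times
  -- `R`, and as `w` times powers of that of `y`, whose far end is intact. For `j ≥ R.length` the
  -- first `L` letters still lie on `x`.
  have key : ∀ j ≥ R.length, window x (-(n * (C + 1 + j) : ℕ)) (n * (C + 1 + j)) ++ R =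
      window x 0 (n * (C + 1) + R.length) ++ window y 0 (n * j) := by
    intro j hj
    have hle : n * (C + 1) + R.length ≤ n * (C + 1 + j) := by
      have : j ≤ n * j := Nat.le_mul_of_pos_left _ hn
      rw [Nat.mul_add n (C + 1) j]
      omega
    obtain ⟨a, ha⟩ := hC (n * (C + 1 + K)) (by
      have := Nat.le_mul_of_pos_left (C + 1 + K) hn
      omega) 0 (n * j)
    have hc := hlit (n * (C + 1 + j))
    rw [hval, show n * (C + 1 + j + K) = n * (C + 1 + K) + n * j by ring, ha] at hc
    rw [Nat.cast_mul, window_shift hym] at hc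
    have hlc := congrArg List.length hc
    simp only [List.length_append, List.length_tail, length_code, length_window,
      Nat.add_sub_cancel] at hlc
    obtain ⟨W, hW⟩ := eq_append_of_code_eq (a := a) (by
      rintro rfl
      rw [Nat.mul_add n (C + 1) j] at hlc
      simp only [List.length_nil] at hlc
      omega) hc.symm
    rw [hW]
    congr 1
    obtain ⟨d, hd⟩ := Nat.exists_eq_add_of_le hle
    have hlW := congrArg List.length hW
    simp only [List.length_append, length_window] at hlW
    nth_rw 2 [hd] at hW
    rw [window_append, List.append_assoc] at hW
    have := (List.append_inj hW (by
      rw [length_window]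
      rw [Nat.mul_add n (C + 1) j] at hlW
      omega)).1
    rw [← this, ← window_shift hxn (-(C + 1 + j)) 0]
    congr 1; push_cast; ring
  constructor
  · have := congrArg wordValue (key R.length le_rfl)
    rw [wordValue_append, wordValue_append, hval, wordValue_window_mul hym,
      wordValue_window_mul hym, hw] at this
    rw [hpow, ← mul_left_inj, ← this, mul_assoc, ← pow_add]
    congr 2
    ring
  · have hnat : ∀ i : ℕ, y i = x (i + (n * (C + 1) + R.length : ℕ)) := by
      intro i
      have := key (i + R.length + 1) (by omega)
      have hle : i + R.length + 1 ≤ n * (i + R.length + 1) := Nat.le_mul_of_pos_left _ hn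
      have he := congrArg (fun l => l[n * (C + 1) + R.length + i]?) this
      rw [List.getElem?_append_left (by
          rw [length_window, Nat.mul_add n (C + 1)]; omega),
        List.getElem?_append_right (by simp), length_window, Nat.add_sub_cancel_left,
        getElem?_window _ _ _ _ (by rw [Nat.mul_add n (C + 1)]; omega),
        getElem?_window _ _ _ _ (by omega), Option.some.injEq, zero_add] at he
      rw [← he, ← periodic_mul hxn (C + 1 + (i + R.length + 1))]
      congr 1; push_cast; ring
    intro i
    have h1 := hnat (i + n * |i|).toNat
    have h0 : 0 ≤ i + n * |i| := by
      have : (1 : ℤ) ≤ n := by exact_mod_cast hn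
      have h3 := neg_abs_le i
      have h4 := abs_nonneg i
      nlinarith
    rw [Int.toNat_of_nonneg h0, periodic_mul hym] at h1
    rw [h1, add_right_comm, periodic_mul hxn]

/-! ### Conjugacy classes of periodic lines -/

theorem mk_mul_comm (a b : SurfaceGroup) : ConjClasses.mk (a * b) = ConjClasses.mk (b * a) := by
  rw [ConjClasses.mk_eq_mk_iff_isConj, isConj_iff]
  exact ⟨b, by group⟩

theorem mk_window_succ {x : ℤ → Letter} {n : ℕ} (hper : ∀ i, x (i + n) = x i) (i : ℤ) :
    ConjClasses.mk (wordValue (window x (i + 1) n)) = ConjClasses.mk (wordValue (window x i n)) := by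
  cases n with
  | zero => rfl
  | succ n =>
    rw [window_append x (i + 1) n 1, window, wordValue_append, mk_mul_comm, ← wordValue_append,
      show i + 1 + (n : ℤ) = i + (n + 1 : ℕ) by push_cast; ring, hper]
    rfl

theorem mk_window {x : ℤ → Letter} {n : ℕ} (hper : ∀ i, x (i + n) = x i) (i : ℤ) :
    ConjClasses.mk (wordValue (window x i n)) = ConjClasses.mk (wordValue (window x 0 n)) := by
  induction i using Int.induction_on with
  | zero => rfl
  | succ i ih => rw [mk_window_succ hper, ih]
  | pred i ih => rw [← ih, ← mk_window_succ hper, sub_add_cancel]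

theorem classLength_le (w : List Letter) : classLength (ConjClasses.mk (wordValue w)) ≤ w.length :=
  Nat.sInf_le ⟨w, rfl, rfl⟩

theorem exists_length_eq_classLength (c : ConjClasses SurfaceGroup) :
    ∃ w : List Letter, w.length = classLength c ∧ ConjClasses.mk (wordValue w) = c := by
  have : {m | ∃ w : List Letter, w.length = m ∧ ConjClasses.mk (wordValue w) = c}.Nonempty := by
    obtain ⟨g, rfl⟩ := ConjClasses.mk_surjective c
    obtain ⟨w, rfl⟩ := wordValue_surjective g
    exact ⟨_, w, rfl, rfl⟩
  exact Nat.sInf_mem this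

theorem Leftmost.norm_pow {x : ℤ → Letter} {n : ℕ} (hx : Leftmost (tn x))
    (hper : ∀ i, x (i + n) = x i) (k : ℕ) : norm (wordValue (window x 0 n) ^ k) = n * k := by
  rw [← wordValue_window_mul hper, hx.norm_window]

theorem norm_pow_le (g : SurfaceGroup) (k : ℕ) : norm (g ^ k) ≤ norm g * k := by
  induction k with
  | zero => simp [norm_one]
  | succ k ih =>
    rw [pow_succ, mul_add, mul_one]
    exact (norm_mul_le _ _).trans (Nat.add_le_add_right ih _)

/-- Powers of the translation have length exactly `n * k`, while conjugation costs a bounded amount;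
so a shorter conjugate fails for a large power. -/
theorem Leftmost.classLength_eq {x : ℤ → Letter} {n : ℕ} (hx : Leftmost (tn x))
    (hper : ∀ i, x (i + n) = x i) : classLength (ConjClasses.mk (wordValue (window x 0 n))) = n := by
  apply le_antisymm
  · simpa using classLength_le (window x 0 n)
  obtain ⟨w, hw, hc⟩ := exists_length_eq_classLength (ConjClasses.mk (wordValue (window x 0 n)))
  rw [← hw]
  obtain ⟨g, hg⟩ := isConj_iff.1 (ConjClasses.mk_eq_mk_iff_isConj.1 hc)
  by_contra hlt
  push Not at hlt
  -- The exponent exceeds the cost of conjugating by `g`.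
  have h1 := hx.norm_pow hper (norm g + norm g⁻¹ + 1)
  rw [← hg, conj_pow] at h1
  have h2 := norm_mul_le (g * wordValue w ^ (norm g + norm g⁻¹ + 1)) g⁻¹
  have h3 := norm_mul_le g (wordValue w ^ (norm g + norm g⁻¹ + 1))
  have h4 := norm_pow_le (wordValue w) (norm g + norm g⁻¹ + 1)
  have h5 := Nat.mul_le_mul_right (norm g + norm g⁻¹ + 1) (norm_wordValue_le w)
  have h6 := Nat.mul_le_mul_right (norm g + norm g⁻¹ + 1) (Nat.succ_le_of_lt hlt)
  rw [Nat.succ_mul] at h6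
  omega

/-! ### Least periods and primitivity. -/

theorem periodic_gcd {α : Type*} {x : ℤ → α} {n d : ℕ} (hn : ∀ i, x (i + n) = x i)
    (hd : ∀ i, x (i + d) = x i) (i : ℤ) : x (i + (Nat.gcd n d : ℕ)) = x i := by
  rw [Nat.gcd_eq_gcd_ab, ← add_assoc, periodic_mul hd, periodic_mul hn]

/-- `n` is the least positive period. -/
def LeastPeriod {α : Type*} (x : ℤ → α) (n : ℕ) : Prop :=
  (∀ i, x (i + n) = x i) ∧ ∀ d : ℕ, 0 < d → (∀ i, x (i + d) = x i) → n ≤ d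

theorem LeastPeriod.dvd {α : Type*} {x : ℤ → α} {n d : ℕ} (h : LeastPeriod x n) (hn : 0 < n)
    (hd : ∀ i, x (i + d) = x i) : n ∣ d := by
  have h1 := h.2 (Nat.gcd n d) (Nat.gcd_pos_of_pos_left _ hn) (periodic_gcd h.1 hd)
  have h2 := Nat.le_antisymm h1 (Nat.gcd_le_left _ hn)
  rw [h2]
  exact Nat.gcd_dvd_right _ _

theorem leastPeriod_of_primitive {x : ℤ → Letter} {n : ℕ} (hn : 0 < n)
    (hper : ∀ i, x (i + n) = x i)
    (hprim : IsPrimitiveClass (ConjClasses.mk (wordValue (window x 0 n)))) : LeastPeriod x n := by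
  refine ⟨hper, fun d hd hxd => ?_⟩
  by_contra hlt
  push Not at hlt
  obtain ⟨k, hk⟩ := Nat.gcd_dvd_left n d
  have hle := Nat.gcd_le_right n hd
  refine hprim (wordValue (window x 0 (Nat.gcd n d))) k ?_ ?_
  · by_contra hk2
    interval_cases k <;> omega
  · rw [← wordValue_window_mul (periodic_gcd hper hxd), ← hk]

/-- A root `z` of the translation `u` commutes with `u`, so `Leftmost.shift_of_conj` applies to the
line and itself: the shift is a multiple of `n`, and `z` is a power of `u`. As `u` has infinite
order, the exponent `k` of the root must be 1. -/
theorem Leftmost.primitive {x : ℤ → Letter} {n : ℕ} (hx : Leftmost (tn x)) (hn : 0 < n)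
    (hper : LeastPeriod x n) (hp : ¬ Pure 2 1 (tn x)) (hp' : ¬ Pure 6 7 (tn x)) :
    IsPrimitiveClass (ConjClasses.mk (wordValue (window x 0 n))) := by
  intro h k hk hc
  obtain ⟨g, hg⟩ := isConj_iff.1 (ConjClasses.mk_eq_mk_iff_isConj.1 hc)
  rw [← conj_pow] at hg
  generalize hz : g * h * g⁻¹ = z at hg
  generalize hu : wordValue (window x 0 n) = u at hg
  obtain ⟨-, M, L, hL, hxL⟩ := hx.shift_of_conj hx hn hn hper.1 hper.1 hp hp hp' (g := z) (by
    rw [hu, ← hg, ← pow_succ, ← pow_succ'])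
  obtain ⟨q, rfl⟩ := hper.dvd hn (d := L) fun i => (hxL i).symm
  rw [wordValue_window_mul hper.1, hu] at hL
  have hz' : z = u ^ ((q : ℤ) - M) := by
    rw [zpow_sub, zpow_natCast, zpow_natCast, hL]
    have : Commute (u ^ M * z) (u ^ M)⁻¹ := by
      rw [← hL]
      exact ((Commute.refl u).pow_pow q M).inv_right
    rw [this.eq, inv_mul_cancel_left]
  have hone : u ^ (((q : ℤ) - M) * k - 1) = 1 := by
    rw [zpow_sub_one, zpow_mul, ← hz', zpow_natCast, hg, mul_inv_cancel]
  have hfin : ∀ j : ℤ, u ^ j = 1 → j = 0 := by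
    intro j hj
    have h1 : u ^ j.natAbs = 1 := by
      rcases Int.natAbs_eq j with h | h
      · rwa [h, zpow_natCast] at hj
      · rwa [h, zpow_neg, zpow_natCast, inv_eq_one] at hj
    have h2 := hx.norm_pow hper.1 j.natAbs
    rw [hu, h1, norm_one] at h2
    rcases Nat.mul_eq_zero.1 h2.symm with h | h <;> omega
  have := hfin _ hone
  have h1 : ((q : ℤ) - M) * k = 1 := by omega
  rcases Int.eq_one_or_neg_one_of_mul_eq_one' h1 with h | h <;> omega

theorem tn_eq {x : ℤ → Letter} (i : ℤ) : pos (x (i + 1)) = opp (pos (x i)) + tn x i := by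
  rw [tn, ← pos_inv, add_sub_cancel]

/-- A line with pure turns has period six. -/
theorem Pure.periodic {x : ℤ → Letter} {p q : Fin 8} (hpq : p = 2 ∧ q = 1 ∨ p = 6 ∧ q = 7)
    (h : Pure p q (tn x)) (i : ℤ) : x (i + 6) = x i := by
  obtain ⟨c, hc⟩ := h
  have ht : ∀ j, tn x j = if (3 : ℤ) ∣ j - c then p else q := fun j => by
    rw [← hc, add_sub_cancel]
  have h6 : ∀ j, pos (x (j + 6)) = opp (opp (opp (opp (opp (opp (pos (x j)) + tn x j) +
      tn x (j + 1)) + tn x (j + 2)) + tn x (j + 3)) + tn x (j + 4)) + tn x (j + 5) := by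
    intro j
    rw [← tn_eq, ← tn_eq, show j + 1 + 1 = j + 2 by ring, ← tn_eq,
      show j + 2 + 1 = j + 3 by ring, ← tn_eq, show j + 3 + 1 = j + 4 by ring, ← tn_eq,
      show j + 4 + 1 = j + 5 by ring, ← tn_eq, show j + 5 + 1 = j + 6 by ring]
  apply pos_injective
  rw [h6, ht, ht, ht, ht, ht, ht]
  generalize pos (x i) = d
  have h3 : (i - c) % 3 = 0 ∨ (i - c) % 3 = 1 ∨ (i - c) % 3 = 2 := by omega
  rcases h3 with h3 | h3 | h3
  · rw [if_pos (by omega), if_neg (by omega), if_neg (by omega), if_pos (by omega),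
      if_neg (by omega), if_neg (by omega)]
    rcases hpq with ⟨rfl, rfl⟩ | ⟨rfl, rfl⟩ <;> revert d <;> decide
  · rw [if_neg (by omega), if_neg (by omega), if_pos (by omega), if_neg (by omega),
      if_neg (by omega), if_pos (by omega)]
    rcases hpq with ⟨rfl, rfl⟩ | ⟨rfl, rfl⟩ <;> revert d <;> decide
  · rw [if_neg (by omega), if_pos (by omega), if_neg (by omega), if_neg (by omega),
      if_pos (by omega), if_neg (by omega)]
    rcases hpq with ⟨rfl, rfl⟩ | ⟨rfl, rfl⟩ <;> revert d <;> decide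

/-! ### Every primitive class contains a leftmost line -/

theorem window_eq_spell (x : ℤ → Letter) (i : ℤ) (l : ℕ) (e : Fin 8) :
    window x i (l + 1) = spell (pos (x i)) (window (tn x) i l ++ [e]) := by
  induction l generalizing i with
  | zero => simp [window, spell]
  | succ l ih =>
    rw [window, ih, window.eq_2 (tn x), List.cons_append, spell, ltr_pos, tn_eq]

theorem length_spell (d : Fin 8) (l : List (Fin 8)) : (spell d l).length = l.length := by
  induction l generalizing d with
  | nil => rfl
  | cons k l ih => simp [spell, ih]

theorem Closes.exists_run {t : ℤ → Fin 8} {i : ℤ} (h : Closes t i) :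
    ∃ j : ℕ, (∀ a : ℕ, a < j → t (i + 3 * a) = 6 ∧ t (i + 3 * a + 1) = 7 ∧ t (i + 3 * a + 2) = 7) ∧
      t (i + 3 * j) = 7 := by
  induction h with
  | last h => exact ⟨0, by simp, by simpa using h⟩
  | @step i h1 h2 h3 _ ih =>
    obtain ⟨j, hj, hj'⟩ := ih
    refine ⟨j + 1, fun a ha => ?_, ?_⟩
    · cases a with
      | zero => simpa using ⟨h1, h2, h3⟩
      | succ a =>
        have := hj a (by omega)
        rw [show i + 3 * ((a + 1 : ℕ) : ℤ) = i + 3 + 3 * a by push_cast; ring]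
        exact this
    · rw [← hj']; congr 1; push_cast; ring

theorem exists_flip_of_run {t : ℤ → Fin 8} (j : ℕ) (i : ℤ) (e : Fin 8)
    (h : ∀ a : ℕ, a < j → t (i + 3 * a) = 6 ∧ t (i + 3 * a + 1) = 7 ∧ t (i + 3 * a + 2) = 7)
    (h' : t (i + 3 * j) = 7) : ∃ l, Flip l (window t i (3 * j + 1) ++ [e]) := by
  induction j generalizing i with
  | zero =>
    simp only [Nat.cast_zero, mul_zero, add_zero] at h'
    simp only [window, h']
    exact flip_seven [e] (by simp)
  | succ j ih =>
    obtain ⟨l, hl⟩ := ih (i + 3) (fun a ha => by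
      have := h (a + 1) (by omega)
      rw [show i + 3 * ((a + 1 : ℕ) : ℤ) = i + 3 + 3 * a by push_cast; ring] at this
      exact this) (by rw [← h']; congr 1; push_cast; ring)
    obtain ⟨h0, h1, h2⟩ := h 0 (by omega)
    simp only [Nat.cast_zero, mul_zero, add_zero] at h0 h1 h2
    refine ⟨2 :: 1 :: 1 :: l, ?_⟩
    rw [show 3 * (j + 1) + 1 = (3 * j + 1) + 3 by ring, window, window, window, h0, h1,
      show i + 1 + 1 = i + 2 by ring, h2, show i + 2 + 1 = i + 3 by ring]
    exact hl.step

/-- A shortenable chain can be shortened. -/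
theorem exists_shorter {x : ℤ → Letter} {i : ℤ} {j : ℕ} (h0 : tn x i = 7) (h1 : tn x (i + 1) = 7)
    (h2 : tn x (i + 2) = 7)
    (h : ∀ a : ℕ, a < j → tn x (i + 3 + 3 * a) = 6 ∧ tn x (i + 3 + 3 * a + 1) = 7 ∧
      tn x (i + 3 + 3 * a + 2) = 7)
    (h' : tn x (i + 3 + 3 * j) = 7) :
    ∃ w, wordValue w = wordValue (window x i (3 * j + 5)) ∧ w.length = 3 * j + 3 := by
  obtain ⟨l, hl⟩ := exists_flip_of_run j (i + 3) 0 h h'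
  have hw : window x i (3 * j + 5) =
      spell (pos (x i)) (7 :: 7 :: 7 :: (window (tn x) (i + 3) (3 * j + 1) ++ [0])) := by
    rw [window_eq_spell x i (3 * j + 4) 0, show 3 * j + 4 = (3 * j + 1) + 3 by ring, window,
      window, window, h0, h1, show i + 1 + 1 = i + 2 by ring, h2, show i + 2 + 1 = i + 3 by ring]
    rfl
  refine ⟨_, ((Cross.pull hl).spell (pos (x i))).1.trans ?_, ?_⟩
  · rw [← wordValue_cons, hw]
    rfl
  · have := hl.length
    simp only [List.length_append, length_window, List.length_singleton] at this
    simp only [length_spell, List.length_cons]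
    omega

/-- Replacing the letters at the indices `i, i + 1, ...` modulo `n`. -/
def patch (x : ℤ → Letter) (n : ℕ) (i : ℤ) (A : List Letter) (m : ℤ) : Letter :=
  (A[((m - i) % n).toNat]?).getD (x m)

theorem patch_periodic {x : ℤ → Letter} {n : ℕ} (hper : ∀ i, x (i + n) = x i) (i : ℤ)
    (A : List Letter) (m : ℤ) : patch x n i A (m + n) = patch x n i A m := by
  rw [patch, patch, hper, add_sub_right_comm, Int.add_emod_right]

theorem patch_apply (x : ℤ → Letter) {n : ℕ} (i : ℤ) (A : List Letter) {m : ℕ} (hm : m < n) :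
    patch x n i A (i + m) = (A[m]?).getD (x (i + m)) := by
  rw [patch, add_sub_cancel_left, ← Int.natCast_mod, Nat.mod_eq_of_lt hm, Int.toNat_natCast]

theorem window_patch (x : ℤ → Letter) {n : ℕ} (i : ℤ) (A : List Letter) (hA : A.length ≤ n) :
    window (patch x n i A) i n = A ++ window x (i + A.length) (n - A.length) := by
  apply List.ext_getElem?
  intro m
  by_cases hm : m < n
  · rw [getElem?_window _ _ _ _ hm, patch_apply _ _ _ hm]
    by_cases hmA : m < A.length
    · rw [List.getElem?_append_left hmA, List.getElem?_eq_getElem hmA]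
      rfl
    · rw [List.getElem?_append_right (by omega), getElem?_window _ _ _ _ (by omega),
        List.getElem?_eq_none (by omega)]
      simp only [Option.getD_none, Option.some.injEq]
      congr 1; omega
  · rw [List.getElem?_eq_none (by simpa using hm), List.getElem?_eq_none]
    simp; omega

/-- Pushing a periodic line across an octagon. -/
theorem exists_push {x : ℤ → Letter} {n : ℕ} (hn : 4 < n) (hper : ∀ i, x (i + n) = x i) (i : ℤ)
    {k k' c : Fin 8} (hk : k = 1 ∧ k' = 7 ∧ c = -1 ∨ k = 7 ∧ k' = 1 ∧ c = 1) (h0 : tn x i = k)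
    (h1 : tn x (i + 1) = k) (h2 : tn x (i + 2) = k) :
    ∃ y : ℤ → Letter, (∀ i, y (i + n) = y i) ∧
      wordValue (window y i n) = wordValue (window x i n) ∧
      (∀ m : ℕ, m < 3 → tn y (i + m) = k') ∧ tn y (i + 3) = tn x (i + 3) + c ∧
      tn y (i + (n - 1 : ℕ)) = tn x (i + (n - 1 : ℕ)) + c ∧
      ∀ m : ℕ, 4 ≤ m → m + 1 < n → tn y (i + m) = tn x (i + m) := by
  generalize hd : pos (x i) = d
  have p1 : pos (x (i + 1)) = opp d + k := by rw [tn_eq, hd, h0]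
  have p2 : pos (x (i + 2)) = opp (opp d + k) + k := by
    rw [show i + 2 = i + 1 + 1 by ring, tn_eq, p1, h1]
  have p3 : pos (x (i + 3)) = opp (opp (opp d + k) + k) + k := by
    rw [show i + 3 = i + 2 + 1 by ring, tn_eq, p2, h2]
  have hw : window x i 4 = spell d [k, k, k, 0] := by
    rw [window_eq_spell x i 3 0, hd, window, window, window, h0, h1,
      show i + 1 + 1 = i + 2 by ring, h2]
    rfl
  have hA : wordValue (spell (d + c) [k', k', k', 0]) = wordValue (spell d [k, k, k, 0]) := by
    rcases hk with ⟨rfl, rfl, rfl⟩ | ⟨rfl, rfl, rfl⟩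
    · rw [octagon, sub_eq_add_neg]
    · rw [octagon, add_sub_cancel_right]
  have hend : opp (opp (opp (opp d + k) + k) + k) =
      opp (opp (opp (opp (d + c) + k') + k') + k') + c := by
    rcases hk with ⟨rfl, rfl, rfl⟩ | ⟨rfl, rfl, rfl⟩ <;> clear * - <;> revert d <;> decide
  let A := spell (d + c) [k', k', k', 0]
  have y0 : patch x n i A i = ltr (d + c) := by
    have := patch_apply x i A (m := 0) (by omega : 0 < n)
    simpa [A, spell] using this
  have y1 : patch x n i A (i + 1) = ltr (opp (d + c) + k') := by
    have := patch_apply x i A (m := 1) (by omega : 1 < n)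
    simpa [A, spell] using this
  have y2 : patch x n i A (i + 2) = ltr (opp (opp (d + c) + k') + k') := by
    have := patch_apply x i A (m := 2) (by omega : 2 < n)
    simpa [A, spell] using this
  have y3 : patch x n i A (i + 3) = ltr (opp (opp (opp (d + c) + k') + k') + k') := by
    have := patch_apply x i A (m := 3) (by omega : 3 < n)
    simpa [A, spell] using this
  have ym : ∀ m : ℕ, 4 ≤ m → m < n → patch x n i A (i + m) = x (i + m) := by
    intro m h4 hm
    rw [patch_apply x i A hm, List.getElem?_eq_none (by simpa [A, spell] using h4)]
    rfl
  refine ⟨patch x n i A, patch_periodic hper i A, ?_, ?_, ?_, ?_, ?_⟩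
  · have h4 : n = 4 + (n - 4) := by omega
    rw [window_patch x i A (by simp [A, spell]; omega), wordValue_append, hA, ← hw]
    conv_rhs => rw [h4, window_append, wordValue_append]
    rfl
  · intro m hm
    interval_cases m
    · simp only [Nat.cast_zero, add_zero]
      rw [tn, y0, y1]
      simp [pos_inv]
    · simp only [Nat.cast_one]
      rw [tn, y1, show i + 1 + 1 = i + 2 by ring, y2]
      simp [pos_inv]
    · simp only [Nat.cast_ofNat]
      rw [tn, y2, show i + 2 + 1 = i + 3 by ring, y3]
      simp [pos_inv]
  · rw [tn, tn, y3, show i + 3 + 1 = i + (4 : ℕ) by push_cast; ring, ym 4 le_rfl hn, pos_inv,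
      pos_inv, pos_ltr, p3, hend]
    abel
  · have hx : x (i + (n - 1 : ℕ) + 1) = x i := by
      rw [← hper i]; congr 1; omega
    have hy : patch x n i A (i + (n - 1 : ℕ) + 1) = patch x n i A i := by
      rw [← patch_periodic hper i A i]; congr 1; omega
    rw [tn, tn, hx, hy, ym _ (by omega) (by omega), y0, pos_ltr, hd]
    abel
  · intro m h4 hm
    rw [tn, tn, ym m h4 (by omega), show i + (m : ℤ) + 1 = i + (m + 1 : ℕ) by push_cast; ring,
      ym (m + 1) (by omega) hm]

theorem sum_window {n : ℕ} {f : ℤ → ℕ} (hper : ∀ i, f (i + n) = f i) (i : ℤ) :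
    ∑ m ∈ Finset.range n, f (i + m) = ∑ m ∈ Finset.range n, f m := by
  have step : ∀ i, ∑ m ∈ Finset.range n, f (i + 1 + m) = ∑ m ∈ Finset.range n, f (i + m) := by
    intro i
    have h1 := Finset.sum_range_succ (fun m : ℕ => f (i + m)) n
    have h2 := Finset.sum_range_succ' (fun m : ℕ => f (i + m)) n
    simp only [Nat.cast_zero, add_zero, Nat.cast_add, Nat.cast_one] at h1 h2
    rw [hper] at h1
    rw [h1, add_left_inj] at h2
    rw [h2]
    refine Finset.sum_congr rfl fun m _ => ?_
    congr 1; ring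
  induction i using Int.induction_on with
  | zero => simp
  | succ i ih => rw [step, ih]
  | pred i ih => rw [← ih, ← step, sub_add_cancel]

/-- The sum of the turns over a period. -/
def turnSum (x : ℤ → Letter) (n : ℕ) : ℕ := ∑ m ∈ Finset.range n, (tn x m).val

theorem turnSum_eq {x : ℤ → Letter} {n : ℕ} (hper : ∀ i, x (i + n) = x i) (i : ℤ) :
    turnSum x n = ∑ m ∈ Finset.range n, (tn x (i + m)).val :=
  (sum_window (f := fun i => (tn x i).val) (fun i => by rw [tn_periodic hper]) i).symm

theorem turnSum_le (x : ℤ → Letter) (n : ℕ) : turnSum x n ≤ 7 * n := by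
  rw [turnSum]
  refine (Finset.sum_le_card_nsmul _ _ 7 fun m _ => ?_).trans ?_
  · exact Nat.le_of_lt_succ (tn x m).isLt
  · simp [mul_comm]

/-- Shortest cyclic words have no backtracks and no shortenable chains, even chains that wrap around
the period. Pushing a half octagon to the left raises the turn sum, so a word with maximal sum has
no `1 1 1`. -/
theorem exists_leftmost {c : ConjClasses SurfaceGroup} {n : ℕ} (hn : 6 < n)
    (hc : classLength c = n) : ∃ x : ℤ → Letter, Leftmost (tn x) ∧ (∀ i, x (i + n) = x i) ∧
      ConjClasses.mk (wordValue (window x 0 n)) = c := by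
  have hmin : ∀ w, ConjClasses.mk (wordValue w) = c → n ≤ w.length := by
    rintro w rfl
    rw [← hc]
    exact classLength_le w
  let W : Set (ℤ → Letter) :=
    {x | (∀ i, x (i + n) = x i) ∧ ConjClasses.mk (wordValue (window x 0 n)) = c}
  have hW : W.Nonempty := by
    obtain ⟨w, hw, rfl⟩ := exists_length_eq_classLength c
    rw [hc] at hw
    refine ⟨patch (fun _ => (.a, true)) n 0 w, patch_periodic (fun _ => rfl) 0 w, ?_⟩
    rw [window_patch _ _ _ hw.le, hw, Nat.sub_self, window, List.append_nil]
  have shorter : ∀ x ∈ W, ∀ (i : ℤ) (l : ℕ) (w : List Letter), l ≤ n →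
      wordValue w = wordValue (window x i l) → l ≤ w.length := by
    rintro x ⟨hper, hx⟩ i l w hl hw
    have h1 := hmin (w ++ window x (i + l) (n - l)) (by
      rw [wordValue_append, hw, ← wordValue_append, ← window_append, Nat.add_sub_cancel' hl,
        mk_window hper, hx])
    simp only [List.length_append, length_window] at h1
    omega
  have short_chain : ∀ x ∈ W, ∀ (i : ℤ) (j : ℕ), 3 * j + 5 ≤ n → tn x i = 7 → tn x (i + 1) = 7 →
      tn x (i + 2) = 7 → (∀ a : ℕ, a < j → tn x (i + 3 + 3 * a) = 6 ∧
      tn x (i + 3 + 3 * a + 1) = 7 ∧ tn x (i + 3 + 3 * a + 2) = 7) → tn x (i + 3 + 3 * j) ≠ 7 := by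
    intro x hx i j hj h0 h1 h2 h h'
    obtain ⟨w, hw, hl⟩ := exists_shorter h0 h1 h2 h h'
    have := shorter x hx i _ w hj hw
    omega
  have no_zero : ∀ x ∈ W, ∀ i, tn x i ≠ 0 := by
    intro x hx i h0
    have := shorter x hx i 2 [] (by omega) (by
      have : x (i + 1) = inv (x i) := pos_injective (sub_eq_zero.1 h0)
      rw [window, window, window, wordValue_cons, this, wordValue_inv, mul_inv_cancel,
        wordValue_nil])
    simp at this
  have no_seven : ∀ x ∈ W, ∀ i, tn x i = 7 → tn x (i + 1) = 7 → tn x (i + 2) = 7 →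
      ¬ Closes (tn x) (i + 3) := by
    intro x hx i h0 h1 h2 hcl
    obtain ⟨j, hj, hj'⟩ := hcl.exists_run
    have four : ∀ m, tn x m = 7 → tn x (m + 1) = 7 → tn x (m + 2) = 7 → tn x (m + 3) ≠ 7 := by
      intro m h0 h1 h2 h3
      exact short_chain x hx m 0 (by omega) h0 h1 h2 (by simp) (by simpa using h3)
    have hper := tn_periodic hx.1
    have q0 : tn x (i + n) = 7 := by rw [hper, h0]
    have q1 : tn x (i + n + 1) = 7 := by rw [add_right_comm, hper, h1]
    have q2 : tn x (i + n + 2) = 7 := by rw [add_right_comm, hper, h2]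
    have last : 0 < j → tn x (i + 3 * j + 1) = 7 ∧ tn x (i + 3 * j + 2) = 7 := by
      intro h
      obtain ⟨a, rfl⟩ : ∃ a, j = a + 1 := ⟨j - 1, by omega⟩
      have := (hj a (by omega)).2
      rw [show i + 3 * ((a + 1 : ℕ) : ℤ) = i + 3 + 3 * a by push_cast; ring]
      exact this
    rcases lt_trichotomy n (3 * j + 1) with hlt | heq | hgt
    -- The chain meets its own start again: some `6` of it falls on one of the three initial `7`s
    -- one period later.
    · obtain ⟨a, ha1, ha2⟩ : ∃ a, n ≤ 3 + 3 * a ∧ 3 + 3 * a ≤ n + 2 :=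
        ⟨(n - 1) / 3, by omega, by omega⟩
      have h6 := (hj a (by omega)).1
      have h3 : 3 + 3 * a = n ∨ 3 + 3 * a = n + 1 ∨ 3 + 3 * a = n + 2 := by omega
      rcases h3 with h3 | h3 | h3
      · rw [show i + 3 + 3 * (a : ℤ) = i + n by omega, q0] at h6
        exact absurd h6 (by decide)
      · rw [show i + 3 + 3 * (a : ℤ) = i + n + 1 by omega, q1] at h6
        exact absurd h6 (by decide)
      · rw [show i + 3 + 3 * (a : ℤ) = i + n + 2 by omega, q2] at h6
        exact absurd h6 (by decide)
    -- The period is `7 7 7 (6 7 7)^(j-1) 6`. Exchanging the first half octagon turns the `6`s on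
    -- both sides of it into `7`s and leaves a shortenable chain that fits into one period.
    · obtain ⟨b, rfl⟩ : ∃ b, j = b + 2 := ⟨j - 2, by omega⟩
      obtain ⟨y, hy, hyv, hym, hy3, hyn, hyr⟩ := exists_push (k := 7) (k' := 1) (c := 1)
        (by omega) hx.1 i (.inr ⟨rfl, rfl, rfl⟩) h0 h1 h2
      have hyW : y ∈ W := ⟨hy, by rw [← mk_window hy i, hyv, mk_window hx.1, hx.2]⟩
      have hmid : ∀ a : ℕ, a < b + 1 → tn y (i + 3 + 3 * a + 1) = 7 ∧
          tn y (i + 3 + 3 * a + 2) = 7 := by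
        intro a ha
        have := (hj a (by omega)).2
        have e1 := hyr (3 + 3 * a + 1) (by omega) (by omega)
        have e2 := hyr (3 + 3 * a + 2) (by omega) (by omega)
        push_cast at e1 e2
        simp only [← add_assoc] at e1 e2
        rw [e1, e2]
        exact this
      refine short_chain y hyW (i + 3) b (by omega) ?_ ?_ ?_ ?_ ?_
      · have := (hj 0 (by omega)).1
        simp only [Nat.cast_zero, mul_zero, add_zero] at this
        rw [hy3, this]; rfl
      · simpa using (hmid 0 (by omega)).1
      · simpa using (hmid 0 (by omega)).2
      · intro a ha
        have e0 := hyr (3 + 3 * (a + 1)) (by omega) (by omega)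
        have h6 := (hj (a + 1) (by omega)).1
        have := hmid (a + 1) (by omega)
        push_cast at e0 h6 this
        rw [show i + 3 + 3 + 3 * (a : ℤ) = i + 3 + 3 * (a + 1) by ring]
        refine ⟨?_, this⟩
        rw [← h6, add_assoc i, e0]
      · have h6 := (hj (b + 1) (by omega)).1
        have hi : i + ((n - 1 : ℕ) : ℤ) = i + 3 + 3 * ((b + 1 : ℕ) : ℤ) := by
          omega
        rw [hi, h6] at hyn
        rw [show i + 3 + 3 + 3 * (b : ℤ) = i + 3 + 3 * ((b + 1 : ℕ) : ℤ) by push_cast; ring, hyn]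
        rfl
    · by_cases hle : 3 * j + 5 ≤ n
      · exact short_chain x hx i j hle h0 h1 h2 hj hj'
      obtain ⟨l1, l2⟩ := last (by omega)
      -- The end of the chain overlaps its start one period later so that four consecutive `7`s
      -- appear.
      have h3 : n = 3 * j + 2 ∨ n = 3 * j + 3 ∨ n = 3 * j + 4 := by omega
      rcases h3 with h3 | h3 | h3
      · refine four (i + 3 * j + 1) l1 ?_ ?_ ?_
        · rw [← q0]; congr 1; omega
        · rw [← q1]; congr 1; omega
        · rw [← q2]; congr 1; omega
      · refine four (i + 3 * j + 1) l1 ?_ ?_ ?_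
        · rw [← l2]; congr 1; ring
        · rw [← q0]; congr 1; omega
        · rw [← q1]; congr 1; omega
      · refine four (i + 3 * j + 3) ?_ ?_ ?_ ?_
        · rw [← hj']; congr 1; ring
        · rw [← q0]; congr 1; omega
        · rw [← q1]; congr 1; omega
        · rw [← q2]; congr 1; omega
  obtain ⟨x, hx, hmax⟩ :=
    (measure fun x : ℤ → Letter => 7 * n - turnSum x n).wf.has_min W hW
  refine ⟨x, ⟨no_zero x hx, fun i h0 h1 h2 => ?_, no_seven x hx⟩, hx⟩
  obtain ⟨y, hy, hyv, hym, hy3, hyn, hyr⟩ := exists_push (k := 1) (k' := 7) (c := -1)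
    (by omega) hx.1 i (.inl ⟨rfl, rfl, rfl⟩) h0 h1 h2
  have hyW : y ∈ W := ⟨hy, by rw [← mk_window hy i, hyv, mk_window hx.1, hx.2]⟩
  -- The two neighbouring turns are nonzero, so each loses exactly one; the three turns `1` gain six
  -- each, and the sum grows by 16.
  have hdec : ∀ q : Fin 8, q ≠ 0 → (q + -1).val + 1 = q.val := by decide
  have e3 := hdec _ (no_zero x hx (i + 3))
  have en := hdec _ (no_zero x hx (i + (n - 1 : ℕ)))
  rw [← hy3] at e3
  rw [← hyn] at en
  obtain ⟨k, hk⟩ : ∃ k, n = k + 1 + 4 := ⟨n - 5, by omega⟩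
  have split : ∀ z : ℤ → Letter, (∀ i, z (i + n) = z i) → turnSum z n =
      ∑ m ∈ Finset.range k, (tn z (i + (m + 4 : ℕ))).val + (tn z (i + (n - 1 : ℕ))).val +
        (tn z (i + 3)).val + (tn z (i + (2 : ℕ))).val + (tn z (i + (1 : ℕ))).val +
        (tn z (i + (0 : ℕ))).val := by
    intro z hz
    rw [turnSum_eq hz i, hk, Finset.sum_range_succ', Finset.sum_range_succ',
      Finset.sum_range_succ', Finset.sum_range_succ', Finset.sum_range_succ]
    rfl
  have hsum : ∑ m ∈ Finset.range k, (tn y (i + (m + 4 : ℕ))).val =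
      ∑ m ∈ Finset.range k, (tn x (i + (m + 4 : ℕ))).val := by
    refine Finset.sum_congr rfl fun m hm => ?_
    rw [Finset.mem_range] at hm
    rw [hyr (m + 4) (by omega) (by omega)]
  have sx := split x hx.1
  have sy := split y hy
  have x0 : (tn x (i + (0 : ℕ))).val = 1 := by
    rw [Nat.cast_zero, add_zero, h0]; rfl
  have x1 : (tn x (i + (1 : ℕ))).val = 1 := by rw [Nat.cast_one, h1]; rfl
  have x2 : (tn x (i + (2 : ℕ))).val = 1 := by rw [Nat.cast_ofNat, h2]; rfl
  have y0 : (tn y (i + (0 : ℕ))).val = 7 := by rw [hym 0 (by omega)]; rfl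
  have y1 : (tn y (i + (1 : ℕ))).val = 7 := by rw [hym 1 (by omega)]; rfl
  have y2 : (tn y (i + (2 : ℕ))).val = 7 := by rw [hym 2 (by omega)]; rfl
  rw [hsum, y0, y1, y2] at sy
  rw [x0, x1, x2] at sx
  have hle := turnSum_le y n
  refine hmax y hyW ?_
  change 7 * n - turnSum y n < 7 * n - turnSum x n
  omega

/-! ### Shapes of states -/

/-- A state without its letter. -/
inductive Shape
  | A | ApL | ApR | AppL | AppR | B | C | Cp | D | EL | ER
  deriving DecidableEq

instance : Fintype Shape :=
  ⟨{.A, .ApL, .ApR, .AppL, .AppR, .B, .C, .Cp, .D, .EL, .ER}, by intro x; cases x <;> decide⟩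

/-- The shape of a state. -/
def MarkovState.shape : MarkovState → Shape
  | .A _ => .A
  | .Ap .left _ => .ApL
  | .Ap .right _ => .ApR
  | .App .left _ => .AppL
  | .App .right _ => .AppR
  | .B _ => .B
  | .C _ => .C
  | .Cp _ => .Cp
  | .D _ => .D
  | .E .left _ => .EL
  | .E .right _ => .ER

/-- The state with given shape and letter. -/
def Shape.state : Shape → Letter → MarkovState
  | .A => .A
  | .ApL => .Ap .left
  | .ApR => .Ap .right
  | .AppL => .App .left
  | .AppR => .App .right
  | .B => .B
  | .C => .C
  | .Cp => .Cp
  | .D => .D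
  | .EL => .E .left
  | .ER => .E .right

/-- The turns of the left edges along which one shape can follow another. -/
def Shape.turns : Shape → Shape → List (Fin 8)
  | .A, .A | .ApL, .A | .ApR, .A | .AppL, .A | .AppR, .A => [2, 3, 4, 5, 6]
  | .A, .B | .ApL, .B | .ApR, .B => [1, 2, 3, 4, 5, 6]
  | .A, .ApL | .ApR, .ApL | .AppR, .ApL | .D, .ApL | .ApL, .AppL => [1]
  | .A, .ApR | .ApL, .ApR | .AppL, .ApR | .ApR, .AppR => [7]
  | .AppL, .B => [2, 3, 4, 5, 6]
  | .AppR, .B | .D, .B => [1, 2, 3, 4, 5]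
  | .D, .A => [2, 3, 4, 5]
  | .D, .ApR => [6]
  | .B, .C | .C, .Cp | .Cp, .D | .Cp, .ER | .EL, .C => [7]
  | .Cp, .EL | .ER, .C => [6]
  | _, _ => []

/-- One shape can follow another along a given turn. -/
def Shape.step (s : Shape) (k : Fin 8) (s' : Shape) : Bool := (Shape.turns s s').contains k

theorem MarkovState.state_shape (J : MarkovState) : J.shape.state J.leftEdge = J := by
  rcases J with x | ⟨_ | _, x⟩ | ⟨_ | _, x⟩ | x | x | x | x | ⟨_ | _, x⟩ <;> rfl

@[simp] theorem Shape.shape_state (s : Shape) (x : Letter) : (s.state x).shape = s := by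
  cases s <;> rfl

@[simp] theorem Shape.leftEdge_state (s : Shape) (x : Letter) : (s.state x).leftEdge = x := by
  cases s <;> rfl

set_option maxRecDepth 10000 in
-- Admissibility depends on the letters only through the turn between the left edges, also after the
-- steps `E`; this is a finite check.
theorem follows_state_iff (s s' : Shape) (x y : Letter) :
    Follows (s.state x) (s'.state y) ↔ s.step (pos y - pos (inv x)) s' := by
  revert x y
  unfold Follows
  cases s <;> cases s' <;> decide

/-! ### Paths of shapes along the turns of a line -/

/-- The shapes `s` form an admissible sequence along the turns `t`. -/
def Traces (s : ℤ → Shape) (t : ℤ → Fin 8) : Prop := ∀ i, (s i).step (t i) (s (i + 1)) = true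

/-! ### Finite facts about the transition table. -/

section Finite

open Shape

theorem Shape.step_zero : ∀ a b, ¬ step a 0 b := by decide

theorem Shape.step_one : ∀ a b, step a 1 b → ∀ c, step b 1 c → ∀ d, ¬ step c 1 d := by decide

theorem Shape.step_seven : ∀ a b, step a 7 b → ∀ c, step b 7 c →
    (∀ d, step c 7 d → d = D ∨ d = ER ∨ d = AppR) ∧ (c = D ∨ c = ER ∨ c = AppR ∨ c = Cp) := by
  decide

theorem Shape.step_seven_of_end : ∀ a, a = D ∨ a = ER ∨ a = AppR → ∀ b, ¬ step a 7 b := by decide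

theorem Shape.step_six_of_end : ∀ a, a = D ∨ a = ER ∨ a = AppR → ∀ b, step a 6 b →
    ∀ c, step b 7 c → ∀ d, step c 7 d → d = D ∨ d = ER ∨ d = AppR := by decide

set_option synthInstance.maxHeartbeats 200000 in
set_option synthInstance.maxSize 1024 in
theorem Shape.step_Cp : ∀ k a, step Cp k a → k = 7 ∨ k = 6 ∧
    ∀ l b, step a l b → l = 7 ∧ ∀ m c, step b m c → m = 7 ∧ c = Cp := by decide

/-- Nondeterminism is short-lived: two different successors along the same turn, if both go on,
become `Cp` and `AppR` two steps later, which make opposite demands on the turns ahead. -/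
theorem Shape.step_fork : ∀ u k v, step u k v → ∀ v', step u k v' → v = v' ∨
    ∀ l w, step v l w → ∀ w', step v' l w' → ∀ m z, step w m z → ∀ z', step w' m z' →
      z = Cp ∧ z' = AppR ∨ z = AppR ∧ z' = Cp := by decide

set_option synthInstance.maxHeartbeats 200000 in
set_option synthInstance.maxSize 1024 in
theorem Shape.step_to_Cp : ∀ c m, step c m Cp → m = 7 ∧ ∀ b l, step b l c → l = 7 ∨
    l = 6 ∧ ∀ a k, step a k b → k = 7 ∧ a = Cp := by decide

/-- The shapes consisting of a single edge after which nothing has ended. -/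
def Shape.Single (s : Shape) : Prop := s = A ∨ s = ApL ∨ s = ApR ∨ s = AppL ∨ s = AppR

instance : DecidablePred Shape.Single := fun s => by unfold Shape.Single; infer_instance

theorem Shape.single_of_step : ∀ a, a ≠ Cp → ∀ k b, step b k a → b ≠ Cp →
    ∀ l c, step a l c → c ≠ Cp → ∀ m d, step c m d → d ≠ Cp → Single a := by decide

theorem Shape.step_single : ∀ a, Single a → ∀ k b, step a k b → Single b →
    k = 1 ∨ k = 7 ∨ b = A := by decide

theorem Shape.step_single_seven : ∀ a, Single a → ∀ b, step a 7 b → Single b →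
    (∀ c, step b 1 c → Single c → c = ApL) ∧ ∀ c, step b 7 c → Single c → ∀ d, ¬ step c 7 d := by
  decide

-- Along two pure periods the shapes are forced to repeat after three steps.
set_option maxRecDepth 10000 in
set_option synthInstance.maxHeartbeats 200000 in
set_option synthInstance.maxSize 1024 in
theorem Shape.step_pure : ∀ p q : Fin 8, p = 2 ∧ q = 1 ∨ p = 6 ∧ q = 7 →
    ∀ x a, step x q a → ∀ b, step a q b → ∀ y, step b p y → ∀ a', step y q a' →
    ∀ b', step a' q b' → ∀ y', step b' p y' → ∀ a'', step y' q a'' → ∀ b'', step a'' q b'' →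
      a' = a ∧ b' = b ∧ y' = y := by
  decide

end Finite

/-! ### Constraints on the turns along a sequence of shapes. -/

section Traces

variable {s s' : ℤ → Shape} {t : ℤ → Fin 8}

theorem Traces.step_eq (h : Traces s t) {i j : ℤ} (hij : j = i + 1) {k : Fin 8} (hk : t i = k) :
    (s i).step k (s j) = true := by
  subst hij hk; exact h i

/-- None of these shapes admits a turn `7`, and `6 7 7` leads from them back to one of them. -/
theorem Traces.not_closes (h : Traces s t) {i : ℤ} (hc : Closes t i) :
    ¬ (s i = .D ∨ s i = .ER ∨ s i = .AppR) := by
  induction hc with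
  | @last i h7 => exact fun hs => Shape.step_seven_of_end _ hs _ (h.step_eq rfl h7)
  | @step i h6 h7 h7' _ ih =>
    exact fun hs => ih (Shape.step_six_of_end _ hs _ (h.step_eq rfl h6) _
      (h.step_eq (by ring) h7) _ (h.step_eq (by ring) h7'))

theorem Traces.leftmost (h : Traces s t) : Leftmost t where
  zero i h0 := Shape.step_zero _ _ (h.step_eq rfl h0)
  one i h1 h2 h3 := Shape.step_one _ _ (h.step_eq rfl h1) _ (h.step_eq (by ring) h2) _
    (h.step_eq rfl h3)
  seven i h1 h2 h3 hc := h.not_closes hc ((Shape.step_seven _ _ (h.step_eq rfl h1) _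
    (h.step_eq (by ring) h2)).1 _ (h.step_eq (by ring) h3))

theorem Traces.eq_Cp (h : Traces s t) {i : ℤ} (h1 : t i = 7) (h2 : t (i + 1) = 7)
    (hc : Closes t (i + 2)) : s (i + 2) = .Cp := by
  have := (Shape.step_seven _ _ (h.step_eq rfl h1) _ (h.step_eq (j := i + 2) (by ring) h2)).2
  have := h.not_closes hc
  tauto

/-- From `Cp` the turns are `7`, which closes the chain, or `6 7 7` back to `Cp`; a chain that never
closes would be pure. -/
theorem Traces.closes_of_Cp (h : Traces s t) {n : ℕ} (hn : 0 < n) (hper : ∀ i, t (i + n) = t i)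
    (hp : ¬ Pure 6 7 t) {i : ℤ} (hi : s i = .Cp) : Closes t i := by
  by_contra hc
  have key : ∀ j : ℤ, s j = .Cp → ¬ Closes t j →
      t j = 6 ∧ t (j + 1) = 7 ∧ t (j + 2) = 7 ∧ s (j + 3) = .Cp ∧ ¬ Closes t (j + 3) := by
    intro j hj hc
    have h0 := h.step_eq (i := j) rfl rfl
    rw [hj] at h0
    obtain h7 | ⟨h6, h1⟩ := Shape.step_Cp _ _ h0
    · exact (hc (.last h7)).elim
    obtain ⟨h7, h2⟩ := h1 _ _ (h (j + 1))
    obtain ⟨h7', h3⟩ := h2 _ _ (h.step_eq (i := j + 1 + 1) (j := j + 3) (by ring) rfl)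
    rw [add_assoc, one_add_one_eq_two] at h7'
    exact ⟨h6, h7, h7', h3, fun h' => hc (.step h6 h7 h7' h')⟩
  have run : ∀ k : ℕ, s (i + 3 * k) = .Cp ∧ ¬ Closes t (i + 3 * k) := by
    intro k
    induction k with
    | zero => simpa using ⟨hi, hc⟩
    | succ k ih =>
      have := key _ ih.1 ih.2
      rw [show i + 3 * ((k + 1 : ℕ) : ℤ) = i + 3 * k + 3 by push_cast; ring]
      exact this.2.2.2
  refine hp (pure_of_run hn hper (by decide) i 0 fun m _ => ?_)
  obtain ⟨k, r, hr, rfl⟩ : ∃ k r : ℕ, r < 3 ∧ m = 3 * k + r :=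
    ⟨m / 3, m % 3, Nat.mod_lt _ (by norm_num), (Nat.div_add_mod m 3).symm⟩
  obtain ⟨h6, h7, h7', -⟩ := key _ (run k).1 (run k).2
  push_cast
  interval_cases r
  · simpa [pat] using h6
  · simpa [pat, add_assoc] using h7
  · simpa [pat, add_assoc] using h7'

theorem Traces.eq_add_three (h : Traces s t) {p q : Fin 8} (hpq : p = 2 ∧ q = 1 ∨ p = 6 ∧ q = 7)
    (hp : Pure p q t) (i : ℤ) : s (i + 3) = s i := by
  obtain ⟨c, hc⟩ := hp
  have key : ∀ k : ℤ, s (c + 3 * k + 2 + 3) = s (c + 3 * k + 2) ∧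
      s (c + 3 * k + 3 + 3) = s (c + 3 * k + 3) ∧ s (c + 3 * k + 4 + 3) = s (c + 3 * k + 4) := by
    intro k
    have hq : ∀ m : ℤ, ¬ 3 ∣ m → t (c + 3 * k + m) = q := fun m hm => by
      rw [add_assoc, hc, if_neg (by omega)]
    have hp : ∀ m : ℤ, 3 ∣ m → t (c + 3 * k + m) = p := fun m hm => by
      rw [add_assoc, hc, if_pos (by omega)]
    obtain ⟨h1, h2, h3⟩ := Shape.step_pure p q hpq _ _
      (h.step_eq (j := c + 3 * k + 2) (by ring) (hq 1 (by norm_num))) _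
      (h.step_eq (j := c + 3 * k + 3) (by ring) (hq 2 (by norm_num))) _
      (h.step_eq (j := c + 3 * k + 4) (by ring) (hp 3 (by norm_num))) _
      (h.step_eq (j := c + 3 * k + 5) (by ring) (hq 4 (by norm_num))) _
      (h.step_eq (j := c + 3 * k + 6) (by ring) (hq 5 (by norm_num))) _
      (h.step_eq (j := c + 3 * k + 7) (by ring) (hp 6 (by norm_num))) _
      (h.step_eq (j := c + 3 * k + 8) (by ring) (hq 7 (by norm_num))) _
      (h.step_eq (j := c + 3 * k + 9) (by ring) (hq 8 (by norm_num)))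
    exact ⟨by rw [← h1]; congr 1; ring, by rw [← h2]; congr 1; ring, by rw [← h3]; congr 1; ring⟩
  obtain ⟨k, r, h0, h3, rfl⟩ : ∃ k r : ℤ, 0 ≤ r ∧ r < 3 ∧ i = c + 3 * k + (2 + r) :=
    ⟨(i - c - 2) / 3, (i - c - 2) % 3, by omega, by omega, by omega⟩
  interval_cases r
  exacts [(key k).1, (key k).2.1, (key k).2.2]

/-! ### Uniqueness -/

theorem Traces.eq_succ (h : Traces s t) (h' : Traces s' t) {n : ℕ} (hn : 0 < n)
    (hper : ∀ i, t (i + n) = t i) (hp : ¬ Pure 6 7 t) {i : ℤ} (hi : s i = s' i) :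
    s (i + 1) = s' (i + 1) := by
  refine (Shape.step_fork _ _ _ (h i) _ (hi ▸ h' i)).resolve_right fun H => ?_
  obtain ⟨h1, h2⟩ | ⟨h1, h2⟩ := H _ _ (h (i + 1)) _ (h' (i + 1)) _ _ (h (i + 1 + 1)) _
    (h' (i + 1 + 1))
  · exact h'.not_closes (h.closes_of_Cp hn hper hp h1) (.inr (.inr h2))
  · exact h.not_closes (h'.closes_of_Cp hn hper hp h2) (.inr (.inr h1))

/-- Going backwards from `Cp` one finds the first octagon of its chain, which `hR` excludes, or an
endless run of `677`. -/
theorem Traces.ne_Cp (h : Traces s t) {n : ℕ} (hn : 0 < n) (hper : ∀ i, t (i + n) = t i)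
    (hp : ¬ Pure 6 7 t) (hR : ∀ i, ¬ (t i = 7 ∧ t (i + 1) = 7 ∧ Closes t (i + 2))) (i : ℤ) :
    s i ≠ .Cp := by
  intro hi
  have key : ∀ j : ℤ, s (j + 3) = .Cp → t j = 7 ∧ t (j + 1) = 6 ∧ t (j + 2) = 7 ∧ s j = .Cp := by
    intro j hj
    have h2 := h.step_eq (i := j + 2) (j := j + 3) (by ring) rfl
    rw [hj] at h2
    obtain ⟨e2, h2⟩ := Shape.step_to_Cp _ _ h2
    obtain e1 | ⟨e1, h1⟩ := h2 _ _ (h.step_eq (i := j + 1) (by ring) rfl)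
    · have := hR (j + 1)
      rw [show j + 1 + 1 = j + 2 by ring, show j + 1 + 2 = j + 3 by ring] at this
      exact (this ⟨e1, e2, h.closes_of_Cp hn hper hp hj⟩).elim
    · obtain ⟨e0, h0⟩ := h1 _ _ (h j)
      exact ⟨e0, e1, e2, h0⟩
  have run : ∀ k : ℕ, s (i - 3 * k) = .Cp := by
    intro k
    induction k with
    | zero => simpa using hi
    | succ k ih =>
      refine (key _ ?_).2.2.2
      rw [← ih]; congr 1; push_cast; ring
  refine hp (pure_of_run hn hper (by decide) (i - 3 * (n + 1 : ℕ)) 2 fun m hm => ?_)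
  obtain ⟨k, r, hr, rfl⟩ : ∃ k r : ℕ, r < 3 ∧ m = 3 * k + r :=
    ⟨m / 3, m % 3, Nat.mod_lt _ (by norm_num), (Nat.div_add_mod m 3).symm⟩
  have hk := run (n - k)
  rw [show i - 3 * ((n - k : ℕ) : ℤ) = i - 3 * (n + 1 : ℕ) + 3 * k + 3 by omega] at hk
  obtain ⟨h6, h7, h7', -⟩ := key _ hk
  push_cast at *
  interval_cases r
  · simpa [pat, add_assoc, Nat.add_mod] using h6
  · simpa [pat, add_assoc, Nat.add_mod] using h7
  · simpa [pat, add_assoc, Nat.add_mod] using h7'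

/-- A completed half octagon on the right synchronizes both sequences at `Cp`. Without one, all
shapes are single edges; these synchronize at `A` after a turn other than `1` and `7`, and at `ApL`
after `7 1`. Only constant turns would remain, and three equal turns `1` or `7` are impossible here.
-/
theorem Traces.exists_eq (h : Traces s t) (h' : Traces s' t) {n : ℕ} (hn : 0 < n)
    (hper : ∀ i, t (i + n) = t i) (hp : ¬ Pure 6 7 t) : ∃ i, s i = s' i := by
  by_cases hR : ∃ i, t i = 7 ∧ t (i + 1) = 7 ∧ Closes t (i + 2)
  · obtain ⟨i, h1, h2, h3⟩ := hR
    exact ⟨i + 2, (h.eq_Cp h1 h2 h3).trans (h'.eq_Cp h1 h2 h3).symm⟩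
  push Not at hR
  have single : ∀ {s : ℤ → Shape}, Traces s t → ∀ i, (s i).Single := by
    intro s h i
    have hC := h.ne_Cp hn hper hp (by simpa using hR)
    exact Shape.single_of_step _ (hC i) _ _ (h.step_eq (i := i - 1) (by ring) rfl) (hC _) _ _ (h i)
      (hC _) _ _ (h (i + 1)) (hC _)
  have S := single h
  have S' := single h'
  by_contra! hne
  have h17 : ∀ i, t i = 1 ∨ t i = 7 := by
    intro i
    by_contra hi
    have h1 := Shape.step_single _ (S i) _ _ (h i) (S _)
    have h2 := Shape.step_single _ (S' i) _ _ (h' i) (S' _)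
    exact hne (i + 1) (by rw [(by tauto : s (i + 1) = .A), (by tauto : s' (i + 1) = .A)])
  have h77 : ∀ i, t i = 7 → t (i + 1) = 7 := by
    intro i hi
    refine (h17 (i + 1)).resolve_left fun h1 => hne (i + 2) ?_
    rw [(Shape.step_single_seven _ (S i) _ (h.step_eq rfl hi) (S _)).1 _
        (h.step_eq (j := i + 2) (by ring) h1) (S _),
      (Shape.step_single_seven _ (S' i) _ (h'.step_eq rfl hi) (S' _)).1 _
        (h'.step_eq (j := i + 2) (by ring) h1) (S' _)]
  have h1 : ∀ i, t i = 1 := by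
    intro i
    refine (h17 i).resolve_right fun hi => ?_
    exact (Shape.step_single_seven _ (S i) _ (h.step_eq rfl hi) (S _)).2 _
      (h.step_eq rfl (h77 _ hi)) (S _) _ (h.step_eq rfl (h77 _ (h77 _ hi)))
  exact h.leftmost.one 0 (h1 _) (h1 _) (h1 _)

/-- A periodic line whose turns are not `677677...` carries at most one periodic sequence of
shapes. -/
theorem Traces.unique (h : Traces s t) (h' : Traces s' t) {n : ℕ} (hn : 0 < n)
    (hs : ∀ i, s (i + n) = s i) (hs' : ∀ i, s' (i + n) = s' i)
    (hper : ∀ i, t (i + n) = t i) (hp : ¬ Pure 6 7 t) : s = s' := by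
  obtain ⟨i, hi⟩ := h.exists_eq h' hn hper hp
  have key : ∀ k : ℕ, s (i + k) = s' (i + k) := by
    intro k
    induction k with
    | zero => simpa using hi
    | succ k ih =>
      have := h.eq_succ h' hn hper hp ih
      push_cast
      rwa [← add_assoc]
  funext j
  -- Agreement spreads forward from `i`; enough periods are added to move `j` beyond `i`.
  rw [← periodic_mul hs (i - j).natAbs j, ← periodic_mul hs' (i - j).natAbs j]
  have hle : 0 ≤ j + n * (i - j).natAbs - i := by
    have h1 : (1 : ℤ) ≤ n := by exact_mod_cast hn
    have h2 : ((i - j).natAbs : ℤ) = |i - j| := Int.natCast_natAbs _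
    rw [h2]
    nlinarith [le_abs_self (i - j), abs_nonneg (i - j)]
  obtain ⟨k, hk⟩ := Int.eq_ofNat_of_zero_le hle
  rw [show j + n * ((i - j).natAbs : ℤ) = i + k by omega]
  exact key k

end Traces

/-! ### Existence -/

/-- What the turns from the index `i` on must satisfy so that a sequence of shapes along them can
pass through a given shape at `i`. -/
def Shape.Fits (t : ℤ → Fin 8) (i : ℤ) : Shape → Prop
  | .A => ¬ (t i = 7 ∧ t (i + 1) = 7 ∧ Closes t (i + 2))
  | .ApL => t (i - 1) = 1 ∧ ¬ (t i = 7 ∧ t (i + 1) = 7 ∧ Closes t (i + 2))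
  | .ApR => ¬ (t i = 7 ∧ Closes t (i + 1))
  | .AppL => t i ≠ 1 ∧ ¬ (t i = 7 ∧ t (i + 1) = 7 ∧ Closes t (i + 2))
  | .AppR => ¬ Closes t i
  | .B | .EL => t i = 7 ∧ t (i + 1) = 7 ∧ Closes t (i + 2)
  | .C => t i = 7 ∧ Closes t (i + 1) ∧ (t (i + 1) = 7 → ¬ Closes t (i + 2))
  | .Cp => Closes t i ∧ (t i = 7 → ¬ Closes t (i + 1))
  | .D => ¬ Closes t i ∧ ¬ (t i = 6 ∧ t (i + 1) = 7 ∧ Closes t (i + 2))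
  | .ER => ¬ Closes t i ∧ t i = 6 ∧ t (i + 1) = 7 ∧ Closes t (i + 2)

/-- The successor is found by looking ahead. Outside a chain it is `B` exactly when a half octagon
or chain on the right starts at `i + 1`, and otherwise the single edge belonging to the turn; inside
a chain, the turns decide between `EL`, `ER` and `D`. The transitions missing from the table are
excluded by `Fits` and leftmostness. -/
theorem Leftmost.exists_step {t : ℤ → Fin 8} (ht : Leftmost t) {i : ℤ} {a : Shape}
    (ha : a.Fits t i) : ∃ b : Shape, a.step (t i) b = true ∧ b.Fits t (i + 1) := by
  have h0 := ht.zero i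
  have h1 := ht.one (i - 1)
  have h7 := ht.seven i
  have hl : t i = 7 → Closes t i := .last
  have hc := @Closes.step t i
  have h7' := ht.seven (i + 1)
  have hi : Closes t i → t i = 7 ∨ t i = 6 ∧ t (i + 1) = 7 ∧ t (i + 2) = 7 ∧ Closes t (i + 3) := by
    rintro (h | ⟨h, h', h'', h3⟩)
    exacts [.inl h, .inr ⟨h, h', h'', h3⟩]
  have e1 : i + 1 + 1 = i + 2 := by ring
  have e2 : i + 1 + 2 = i + 3 := by ring
  have e3 : i + 1 - 1 = i := by ring
  have e4 : i + 1 + 3 = i + 4 := by ring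
  rw [sub_add_cancel, show i - 1 + 2 = i + 1 by ring] at h1
  rw [e1, e2, e4] at h7'
  cases a <;> simp only [Shape.Fits] at ha
  case A =>
    by_cases hR : t (i + 1) = 7 ∧ t (i + 2) = 7 ∧ Closes t (i + 3)
    · exact ⟨.B, (by decide : ∀ k, k ≠ 0 → k ≠ 7 → Shape.step .A k .B) _
        (by grind) (by grind),
        by simpa only [Shape.Fits, e1, e2] using hR⟩
    by_cases h : t i = 1
    · exact ⟨.ApL, h ▸ rfl, by simp only [Shape.Fits, e1, e2, e3]; grind⟩
    by_cases h' : t i = 7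
    · exact ⟨.ApR, h' ▸ rfl, by simp only [Shape.Fits, e1]; grind⟩
    exact ⟨.A, (by decide : ∀ k, k ≠ 0 → k ≠ 1 → k ≠ 7 → Shape.step .A k .A) _
      (by grind) (by grind) (by grind),
      by simpa only [Shape.Fits, e1, e2] using hR⟩
  case ApL =>
    by_cases hR : t (i + 1) = 7 ∧ t (i + 2) = 7 ∧ Closes t (i + 3)
    · exact ⟨.B, (by decide : ∀ k, k ≠ 0 → k ≠ 7 → Shape.step .ApL k .B) _
        (by grind) (by grind),
        by simpa only [Shape.Fits, e1, e2] using hR⟩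
    by_cases h : t i = 1
    · exact ⟨.AppL, h ▸ rfl, by simp only [Shape.Fits, e1, e2]; grind⟩
    by_cases h' : t i = 7
    · exact ⟨.ApR, h' ▸ rfl, by simp only [Shape.Fits, e1]; grind⟩
    exact ⟨.A, (by decide : ∀ k, k ≠ 0 → k ≠ 1 → k ≠ 7 → Shape.step .ApL k .A) _
      (by grind) (by grind) (by grind),
      by simpa only [Shape.Fits, e1, e2] using hR⟩
  case ApR =>
    by_cases hR : t (i + 1) = 7 ∧ t (i + 2) = 7 ∧ Closes t (i + 3)
    · exact ⟨.B, (by decide : ∀ k, k ≠ 0 → k ≠ 7 → Shape.step .ApR k .B) _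
        (by grind) (by grind),
        by simpa only [Shape.Fits, e1, e2] using hR⟩
    by_cases h : t i = 1
    · exact ⟨.ApL, h ▸ rfl, by simp only [Shape.Fits, e1, e2, e3]; grind⟩
    by_cases h' : t i = 7
    · exact ⟨.AppR, h' ▸ rfl, by simp only [Shape.Fits]; grind⟩
    exact ⟨.A, (by decide : ∀ k, k ≠ 0 → k ≠ 1 → k ≠ 7 → Shape.step .ApR k .A) _
      (by grind) (by grind) (by grind),
      by simpa only [Shape.Fits, e1, e2] using hR⟩
  case AppL =>
    by_cases hR : t (i + 1) = 7 ∧ t (i + 2) = 7 ∧ Closes t (i + 3)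
    · exact ⟨.B, (by decide : ∀ k, k ≠ 0 → k ≠ 1 → k ≠ 7 → Shape.step .AppL k .B) _
        (by grind) (by grind) (by grind),
        by simpa only [Shape.Fits, e1, e2] using hR⟩
    by_cases h' : t i = 7
    · exact ⟨.ApR, h' ▸ rfl, by simp only [Shape.Fits, e1]; grind⟩
    exact ⟨.A, (by decide : ∀ k, k ≠ 0 → k ≠ 1 → k ≠ 7 → Shape.step .AppL k .A) _
      (by grind) (by grind) (by grind),
      by simpa only [Shape.Fits, e1, e2] using hR⟩
  case AppR =>
    by_cases hR : t (i + 1) = 7 ∧ t (i + 2) = 7 ∧ Closes t (i + 3)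
    · exact ⟨.B, (by decide : ∀ k, k ≠ 0 → k ≠ 6 → k ≠ 7 → Shape.step .AppR k .B) _
        (by grind) (by grind) (by grind),
        by simpa only [Shape.Fits, e1, e2] using hR⟩
    by_cases h : t i = 1
    · exact ⟨.ApL, h ▸ rfl, by simp only [Shape.Fits, e1, e2, e3]; grind⟩
    exact ⟨.A, (by decide : ∀ k, k ≠ 0 → k ≠ 1 → k ≠ 7 → Shape.step .AppR k .A) _
      (by grind) (by grind) (by grind),
      by simpa only [Shape.Fits, e1, e2] using hR⟩
  case B => exact ⟨.C, ha.1 ▸ rfl, by simp only [Shape.Fits, e1, e2]; grind⟩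
  case C => exact ⟨.Cp, ha.1 ▸ rfl, by simp only [Shape.Fits, e1]; grind⟩
  case Cp =>
    obtain h | ⟨h, hR⟩ := hi ha.1
    · by_cases hQ : t (i + 1) = 6 ∧ t (i + 2) = 7 ∧ Closes t (i + 3)
      · exact ⟨.ER, h ▸ rfl, by simp only [Shape.Fits, e1, e2]; grind⟩
      · exact ⟨.D, h ▸ rfl, by simp only [Shape.Fits, e1, e2]; grind⟩
    · exact ⟨.EL, h ▸ rfl, by simpa only [Shape.Fits, e1, e2] using hR⟩
  case D =>
    by_cases hR : t (i + 1) = 7 ∧ t (i + 2) = 7 ∧ Closes t (i + 3)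
    · exact ⟨.B, (by decide : ∀ k, k ≠ 0 → k ≠ 6 → k ≠ 7 → Shape.step .D k .B) _
        (by grind) (by grind) (by grind),
        by simpa only [Shape.Fits, e1, e2] using hR⟩
    by_cases h : t i = 1
    · exact ⟨.ApL, h ▸ rfl, by simp only [Shape.Fits, e1, e2, e3]; grind⟩
    by_cases h' : t i = 6
    · exact ⟨.ApR, h' ▸ rfl, by simp only [Shape.Fits, e1]; grind⟩
    exact ⟨.A, (by decide : ∀ k, k ≠ 0 → k ≠ 1 → k ≠ 6 → k ≠ 7 → Shape.step .D k .A) _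
      (by grind) (by grind) (by grind) (by grind),
      by simpa only [Shape.Fits, e1, e2] using hR⟩
  case EL => exact ⟨.C, ha.1 ▸ rfl, by simp only [Shape.Fits, e1, e2]; grind⟩
  case ER => exact ⟨.C, ha.2.1 ▸ rfl, by simp only [Shape.Fits, e1, e2]; grind⟩

theorem Leftmost.exists_path {t : ℤ → Fin 8} (ht : Leftmost t) :
    ∃ f : ℕ → Shape, ∀ i : ℕ, (f i).step (t i) (f (i + 1)) = true := by
  obtain ⟨a, ha⟩ : ∃ a : Shape, a.Fits t (0 : ℕ) := by
    by_cases h : t 0 = 7 ∧ t (0 + 1) = 7 ∧ Closes t (0 + 2)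
    exacts [⟨.B, h⟩, ⟨.A, h⟩]
  choose! g hg using fun (i : ℕ) (a : Shape) (h : a.Fits t i) => ht.exists_step h
  let f : ℕ → Shape := fun i => Nat.rec a (fun i b => g i b) i
  have hf : ∀ i : ℕ, (f i).Fits t i := by
    intro i
    induction i with
    | zero => exact ha
    | succ i ih => exact_mod_cast (hg i _ ih).2
  exact ⟨f, fun i => (hg i _ (hf i)).1⟩

theorem exists_traces_of_path {t : ℤ → Fin 8} {f : ℕ → Shape} {N a : ℕ} (hN : 0 < N)
    (hper : ∀ i, t (i + N) = t i) (hf : ∀ i : ℕ, (f i).step (t i) (f (i + 1)) = true)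
    (h : f (a + N) = f a) : ∃ s, Traces s t ∧ ∀ i, s (i + N) = s i := by
  refine ⟨fun i => f (a + ((i - a) % N).toNat), fun i => ?_, fun i => ?_⟩
  · obtain ⟨r, hr⟩ := Int.eq_ofNat_of_zero_le (Int.emod_nonneg (i - a) (by omega : (N : ℤ) ≠ 0))
    have hlt : r < N := by
      have := Int.emod_lt_of_pos (i - a) (by omega : (0 : ℤ) < N)
      omega
    have ht : t i = t (a + r : ℕ) := by
      rw [← periodic_mul hper ((i - a) / N) (a + r : ℕ), Nat.cast_add, ← hr, add_assoc,
        Int.emod_add_mul_ediv, add_sub_cancel]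
    have hnext : f (a + ((i + 1 - a) % N).toNat) = f (a + r + 1) := by
      rw [show i + 1 - a = i - a + 1 by ring, ← Int.emod_add_emod, hr,
        show ((r : ℤ) + 1) % N = ((r + 1) % N : ℕ) by push_cast; rfl, Int.toNat_natCast]
      rcases Nat.lt_or_ge (r + 1) N with h1 | h1
      · rw [Nat.mod_eq_of_lt h1, add_assoc]
      · rw [show r + 1 = N by omega, Nat.mod_self, add_zero, ← h, add_assoc, show r + 1 = N by omega]
    simp only [hr, hnext, ht]
    exact hf _
  · simp only [show i + (N : ℤ) - a = i - a + N by ring, Int.add_emod_right]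

theorem Leftmost.exists_traces {t : ℤ → Fin 8} (ht : Leftmost t) {n : ℕ} (hn : 0 < n)
    (hper : ∀ i, t (i + n) = t i) (hp : ¬ Pure 6 7 t) :
    ∃ s, Traces s t ∧ ∀ i, s (i + n) = s i := by
  obtain ⟨f, hf⟩ := ht.exists_path
  -- A shape repeats at two multiples of `n`, which gives a sequence whose period is a multiple of
  -- `n`.
  obtain ⟨k, l, hkl, he⟩ := Finite.exists_ne_map_eq_of_infinite fun k : ℕ => f (n * k)
  wlog hlt : k < l generalizing k l
  · exact this l k hkl.symm he.symm (by omega)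
  obtain ⟨m, rfl⟩ := Nat.exists_eq_add_of_lt hlt
  have hN : 0 < n * (m + 1) := Nat.mul_pos hn m.succ_pos
  have hperN : ∀ i, t (i + (n * (m + 1) : ℕ)) = t i := fun i => by
    rw [Nat.cast_mul, periodic_mul hper]
  obtain ⟨s, hs, hsN⟩ := exists_traces_of_path (a := n * k) hN hperN hf
    (by rw [← mul_add, ← add_assoc]; exact he.symm)
  refine ⟨s, hs, fun i => ?_⟩
  -- The shift by `n` follows the same turns; by uniqueness it equals the original, so `n` itself is
  -- a period.
  have hs' : Traces (fun i => s (i + n)) t := fun i => by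
    have := hs (i + n)
    rwa [hper, add_right_comm] at this
  refine congrFun (hs'.unique hs hN (fun i => ?_) hsN hperN hp) i
  rw [add_right_comm, hsN]

/-! ### Periodic elements of the Markov chain -/

/-- The line of letters along the left edges of a sequence of states. -/
def leftLine (J : ℤ → MarkovState) (i : ℤ) : Letter := (J i).leftEdge

theorem mem_chain_iff {J : ℤ → MarkovState} :
    J ∈ chain ↔ Traces (fun i => (J i).shape) (tn (leftLine J)) := by
  refine forall_congr' fun i => ?_
  rw [← (J i).state_shape, ← (J (i + 1)).state_shape, follows_state_iff]
  rfl

theorem iterate_shift (k : ℕ) (J : ℤ → MarkovState) : shift^[k] J = fun i => J (i + k) := by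
  induction k generalizing J with
  | zero => simp
  | succ k ih =>
    rw [Function.iterate_succ_apply, ih]
    funext i
    simp only [shift]
    congr 1; push_cast; ring

theorem isPeriodicPt_shift_iff {k : ℕ} {J : ℤ → MarkovState} :
    Function.IsPeriodicPt shift k J ↔ ∀ i, J (i + k) = J i := by
  rw [Function.IsPeriodicPt, Function.IsFixedPt, iterate_shift, funext_iff]

theorem mem_periodPoints_iff {n : ℕ} (hn : 0 < n) {J : ℤ → MarkovState} :
    J ∈ periodPoints n ↔ J ∈ chain ∧ LeastPeriod J n := by
  refine and_congr_right fun _ => ⟨?_, fun h => ?_⟩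
  · rintro rfl
    exact ⟨isPeriodicPt_shift_iff.1 (Function.isPeriodicPt_minimalPeriod _ _), fun d hd h =>
      (isPeriodicPt_shift_iff.2 h).minimalPeriod_le hd⟩
  · have hper := isPeriodicPt_shift_iff.2 h.1
    exact le_antisymm (hper.minimalPeriod_le hn) (h.2 _ (hper.minimalPeriod_pos hn)
      (isPeriodicPt_shift_iff.1 (Function.isPeriodicPt_minimalPeriod _ _)))

theorem readClass_eq (n : ℕ) (J : ℤ → MarkovState) :
    readClass n J = ConjClasses.mk (wordValue (window (leftLine J) 0 n)) := by
  rw [window_eq_ofFn]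
  simp only [zero_add]
  rfl

theorem ext_of_shape {J K : ℤ → MarkovState} (hs : ∀ i, (J i).shape = (K i).shape)
    (hx : ∀ i, leftLine J i = leftLine K i) : J = K := by
  funext i
  rw [← (J i).state_shape, hs, ← (K i).state_shape, Shape.shape_state]
  exact congrArg _ (hx i)

/-- On a pure line the shapes have period 3 and the letters period 6, so the least period would be
at most 6. -/
theorem not_pure_of_chain {n : ℕ} (hn : 6 < n) {J : ℤ → MarkovState} (hJ : J ∈ chain)
    (hper : LeastPeriod J n) {p q : Fin 8} (hpq : p = 2 ∧ q = 1 ∨ p = 6 ∧ q = 7) :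
    ¬ Pure p q (tn (leftLine J)) := by
  intro hp
  have hs := (mem_chain_iff.1 hJ).eq_add_three hpq hp
  have : (fun i => J (i + (6 : ℕ))) = J := ext_of_shape
    (fun i => by
      have h3 := hs (i + 3)
      rw [hs i, add_assoc] at h3
      exact h3)
    (fun i => hp.periodic hpq i)
  exact absurd (hper.2 6 (by norm_num) (congrFun this)) (by omega)

theorem not_pure_of_leastPeriod {n : ℕ} (hn : 6 < n) {x : ℤ → Letter} (hper : LeastPeriod x n)
    {p q : Fin 8} (hpq : p = 2 ∧ q = 1 ∨ p = 6 ∧ q = 7) : ¬ Pure p q (tn x) := fun hp =>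
  absurd (hper.2 6 (by norm_num) (hp.periodic hpq)) (by omega)

theorem eq_of_leftLine_eq {n : ℕ} (hn : 0 < n) {J K : ℤ → MarkovState} (hJ : J ∈ chain)
    (hK : K ∈ chain) (hJn : ∀ i, J (i + n) = J i) (hKn : ∀ i, K (i + n) = K i)
    (h : leftLine J = leftLine K) (hp : ¬ Pure 6 7 (tn (leftLine J))) : J = K := by
  have hK' := mem_chain_iff.1 hK
  rw [← h] at hK'
  refine ext_of_shape (congrFun ((mem_chain_iff.1 hJ).unique hK' hn (fun i => ?_) (fun i => ?_)
    (tn_periodic fun i => ?_) hp)) (congrFun h)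
  · simp only [hJn]
  · simp only [hKn]
  · simp only [leftLine, hJn]

theorem shift_mem_chain {J : ℤ → MarkovState} (hJ : J ∈ chain) (k : ℕ) :
    (fun i => J (i + k)) ∈ chain := fun i => by
  have := hJ (i + k)
  rwa [add_right_comm] at this

theorem LeastPeriod.shift {α : Type*} {x : ℤ → α} {n : ℕ} (h : LeastPeriod x n) (k : ℕ) :
    LeastPeriod (fun i => x (i + k)) n := by
  refine ⟨fun i => ?_, fun d hd hx => h.2 d hd fun i => ?_⟩
  · simp only [add_right_comm i (n : ℤ), h.1]
  · have := hx (i - k)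
    simpa only [add_right_comm _ (d : ℤ), sub_add_cancel] using this

/-- If the letters had a smaller period, the corresponding shift of `J` would have the same left
line and hence equal `J`. -/
theorem leastPeriod_leftLine {n : ℕ} (hn : 6 < n) {J : ℤ → MarkovState} (hJ : J ∈ chain)
    (hper : LeastPeriod J n) : LeastPeriod (leftLine J) n := by
  have hx : ∀ i, leftLine J (i + n) = leftLine J i := fun i => by simp only [leftLine, hper.1]
  refine ⟨hx, fun d hd hxd => ?_⟩
  have hn0 : 0 < n := by omega
  have hg : (fun i => J (i + (Nat.gcd n d : ℕ))) = J :=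
    eq_of_leftLine_eq hn0 (shift_mem_chain hJ _) hJ (hper.shift _).1 hper.1
      (funext fun i => periodic_gcd hx hxd i)
      (not_pure_of_chain hn (shift_mem_chain hJ _) (hper.shift _) (.inr ⟨rfl, rfl⟩))
  exact (hper.2 _ (Nat.gcd_pos_of_pos_left _ hn0) (congrFun hg)).trans (Nat.gcd_le_right _ hd)

/-! ### The fibres of `readClass` are shift orbits. -/

theorem mapsTo_readClass {n : ℕ} (hn : 6 < n) :
    Set.MapsTo (readClass n) (periodPoints n) (primitiveClasses n) := by
  intro J hJ
  obtain ⟨hJ, hper⟩ := (mem_periodPoints_iff (by omega)).1 hJ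
  have hx := (mem_chain_iff.1 hJ).leftmost
  have hl := leastPeriod_leftLine hn hJ hper
  rw [readClass_eq]
  exact ⟨hx.primitive (by omega) hl (not_pure_of_chain hn hJ hper (.inl ⟨rfl, rfl⟩))
    (not_pure_of_chain hn hJ hper (.inr ⟨rfl, rfl⟩)), hx.classLength_eq hl.1⟩

theorem exists_mem_periodPoints {n : ℕ} (hn : 6 < n) {c : ConjClasses SurfaceGroup}
    (hc : c ∈ primitiveClasses n) : ∃ J ∈ periodPoints n, readClass n J = c := by
  obtain ⟨x, hx, hxn, rfl⟩ := exists_leftmost hn hc.2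
  have hl := leastPeriod_of_primitive (by omega) hxn hc.1
  obtain ⟨s, hs, hsn⟩ := hx.exists_traces (by omega) (tn_periodic hxn)
    (not_pure_of_leastPeriod hn hl (.inr ⟨rfl, rfl⟩))
  have hline : leftLine (fun i => (s i).state (x i)) = x := funext fun i => by simp [leftLine]
  refine ⟨fun i => (s i).state (x i), (mem_periodPoints_iff (by omega)).2 ⟨?_, ?_, ?_⟩, ?_⟩
  · rw [mem_chain_iff, hline]
    simpa using hs
  · intro i
    simp only [hxn, hsn]
  · intro d hd h
    refine hl.2 d hd fun i => ?_
    have := congrArg MarkovState.leftEdge (h i)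
    simpa using this
  · rw [readClass_eq, hline]

theorem eq_shift_of_readClass_eq {n : ℕ} (hn : 6 < n) {J K : ℤ → MarkovState}
    (hJ : J ∈ periodPoints n) (hK : K ∈ periodPoints n) (h : readClass n K = readClass n J) :
    ∃ k < n, (fun i => J (i + k)) = K := by
  have hn0 : 0 < n := by omega
  obtain ⟨hJ, hJn⟩ := (mem_periodPoints_iff hn0).1 hJ
  obtain ⟨hK, hKn⟩ := (mem_periodPoints_iff hn0).1 hK
  rw [readClass_eq, readClass_eq, ConjClasses.mk_eq_mk_iff_isConj, isConj_iff] at h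
  obtain ⟨g, hg⟩ := h
  obtain ⟨-, -, L, -, hL⟩ := Leftmost.shift_of_conj (mem_chain_iff.1 hJ).leftmost
    (mem_chain_iff.1 hK).leftmost hn0 hn0 (leastPeriod_leftLine hn hJ hJn).1
    (leastPeriod_leftLine hn hK hKn).1 (not_pure_of_chain hn hJ hJn (.inl ⟨rfl, rfl⟩))
    (not_pure_of_chain hn hK hKn (.inl ⟨rfl, rfl⟩)) (not_pure_of_chain hn hK hKn (.inr ⟨rfl, rfl⟩))
    (g := g) (by rw [← hg]; group)
  refine ⟨L % n, Nat.mod_lt _ hn0, ?_⟩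
  have hmod : (fun i => J (i + (L % n : ℕ))) = fun i => J (i + L) := funext fun i => by
    rw [← periodic_mul hJn.1 (L / n : ℕ) (i + (L % n : ℕ)), add_assoc]
    congr 2
    exact_mod_cast Nat.mod_add_div L n
  rw [hmod]
  exact eq_of_leftLine_eq hn0 (shift_mem_chain hJ L) hK (hJn.shift L).1 hKn.1
    (funext fun i => (hL i).symm)
    (not_pure_of_chain hn (shift_mem_chain hJ _) (hJn.shift _) (.inr ⟨rfl, rfl⟩))

theorem setOf_readClass_eq {n : ℕ} (hn : 6 < n) {J : ℤ → MarkovState} (hJ : J ∈ periodPoints n) :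
    {K ∈ periodPoints n | readClass n K = readClass n J} =
      (fun (k : ℕ) (i : ℤ) => J (i + k)) '' Finset.range n := by
  ext K
  constructor
  · rintro ⟨hK, h⟩
    obtain ⟨k, hk, rfl⟩ := eq_shift_of_readClass_eq hn hJ hK h
    exact ⟨k, by simpa using hk, rfl⟩
  · rintro ⟨k, -, rfl⟩
    obtain ⟨hJ, hper⟩ := (mem_periodPoints_iff (by omega)).1 hJ
    refine ⟨(mem_periodPoints_iff (by omega)).2 ⟨shift_mem_chain hJ k, hper.shift k⟩, ?_⟩
    rw [readClass_eq, readClass_eq, ← mk_window (leastPeriod_leftLine hn hJ hper).1 k]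
    congr 2
    rw [window_eq_iff]
    intro m _
    simp only [leftLine]
    congr 2; ring

theorem LeastPeriod.injOn_shift {α : Type*} {x : ℤ → α} {n : ℕ} (h : LeastPeriod x n) :
    Set.InjOn (fun (k : ℕ) (i : ℤ) => x (i + k)) (Finset.range n) := by
  intro k hk l hl hkl
  wlog hlt : k < l generalizing k l
  · by_contra hne
    exact hne (this hl hk hkl.symm (by omega)).symm
  have := h.2 (l - k) (by omega) fun i => by
    have := congrFun hkl (i - k)
    simp only [sub_add_cancel] at this
    rw [this]
    congr 1; omega
  simp at hl hk
  omega

theorem card_markovState : Nat.card MarkovState = 88 := by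
  rw [Nat.card_eq_fintype_card]
  decide

end SurfaceChain

theorem theorem2 :
    Nat.card SurfaceChain.MarkovState = 88 ∧
    ∀ n : ℕ, 6 < n →
      Set.MapsTo (SurfaceChain.readClass n) (SurfaceChain.periodPoints n)
        (SurfaceChain.primitiveClasses n) ∧
      ∀ c ∈ SurfaceChain.primitiveClasses n,
        {J ∈ SurfaceChain.periodPoints n | SurfaceChain.readClass n J = c}.ncard = n := by
  refine ⟨SurfaceChain.card_markovState, fun n hn => ⟨SurfaceChain.mapsTo_readClass hn, ?_⟩⟩
  intro c hc
  obtain ⟨J, hJ, rfl⟩ := SurfaceChain.exists_mem_periodPoints hn hc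
  rw [SurfaceChain.setOf_readClass_eq hn hJ,
    ((SurfaceChain.mem_periodPoints_iff (by omega)).1 hJ).2.injOn_shift.ncard_image,
    Set.ncard_coe_finset,
    Finset.card_range]
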